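/- Let $a>0$ and $b\ge 0$, and let $\pi=\mathrm{PBD}(a;0,1,b)$ be the equilibrium distribution on $\mathbb Z_+=\{0,1,2,\dots\}$ of the birth-death process with birth rates $a$ and death rates $\beta_i=i+b\,i(i-1)$, that is, $$\pi_n=\frac{a^n}{\prod_{i=1}^n\beta_i}\Bigl(1+\sum_{j\ge1}\frac{a^j}{\prod_{i=1}^j\beta_i}\Bigr)^{-1},\qquad n\in\mathbb Z_+ .$$ Let $\mathcal F$ be the set of functions $f:\mathbb Z_+\to\mathbb R$ with $|f(x)-f(y)|\le|x-y|$ for all $x,y\in\mathbb Z_+$, and write $\|u\|=\sup_{i\in\mathbb Z_+}|u(i)|$, $\Delta u(i)=u(i+1)-u(i)$, $\Delta^2u=\Delta(\Delta u)$ and $x\wedge y=\min\{x,y\}$. Then $\pi$ is a probability distribution, and for every $f\in\mathcal F$ the sum $\pi(f)=\sum_{n\ge0} f(n)\pi_n$ converges absolutely and there is a unique function $\tilde g_f:\mathbb Z_+\to\mathbb R$ with $\tilde g_f(0)=\tilde g_f(1)$ that solves the Stein equation $$a\,\tilde g_f(i+1)-[\,i+b\,i(i-1)]\,\tilde g_f(i)=f(i)-\pi(f),\qquad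 i\in\mathbb Z_+ .$$ If $b>0$, then $$\sup_{f\in\mathcal F}\|\tilde g_f\|\le\frac{1}{1+\frac{2ab}{a+2b+2}}\wedge\frac{\sqrt{ab+(b-1)^2/4}+(b-1)/2}{ab},$$ $$\sup_{f\in\mathcal F}\|\Delta\tilde g_f\|\le\Bigl(\frac1{1+b}+\frac{a+2b}{a^2+2a+2+2b(a+1)}\Bigr)\wedge\Bigl(\frac1{\sqrt{ab}}+\frac1a\Bigr),$$ $$\sup_{f\in\mathcal F}\|\Delta^2\tilde g_f\|\le\frac2a+\frac{b}{(a+1)b+1+a/2}.$$ If $b=0$ (the Poisson distribution with mean $a$), then the limiting bounds hold: $$\sup_{f\in\mathcal F}\|\tilde g_f\|\le1,\qquad \sup_{f\in\mathcal F}\|\Delta\tilde g_f\|\le\frac{a^2+3a+2}{a^2+2a+2},\qquad \sup_{f\in\mathcal F}\|\Delta^2\tilde g_f\|\le\frac2a .$$ -/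

import Mathlib

/-- The unnormalised weight `∏_{i<n} α_i / ∏_{1≤i≤n} β_i` of the state `n` of a birth-death
process with birth rates `α_i` and death rates `β_i`. -/
noncomputable def bdWeight (α β : ℕ → ℝ) (n : ℕ) : ℝ :=
  (∏ i ∈ Finset.range n, α i) / (∏ i ∈ Finset.Icc 1 n, β i)

/-- The equilibrium probability `π_n` of a birth-death process on `{0, 1, 2, …}`. -/
noncomputable def bdProb (α β : ℕ → ℝ) (n : ℕ) : ℝ :=
  bdWeight α β n * (1 + ∑' j : ℕ, bdWeight α β (j + 1))⁻¹

/-- The death rate `i + b i (i - 1)`. -/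
def deathRate (b : ℝ) (i : ℕ) : ℝ := (i : ℝ) + b * ((i : ℝ) * ((i : ℝ) - 1))

/-- The probability function of `PBD(a; 0, 1, b)`: birth rates `a`, death rates
`i + b i (i - 1)`. -/
noncomputable def pbd (a b : ℝ) : ℕ → ℝ := bdProb (fun _ => a) (deathRate b)

/-- The expectation `PBD(a; 0, 1, b)(f) = ∑ f(n) π_n`. -/
noncomputable def pbdExp (a b : ℝ) (f : ℕ → ℝ) : ℝ := ∑' n : ℕ, f n * pbd a b n

/-- The test functions of the Wasserstein distance: 1-Lipschitz functions on `{0, 1, 2, …}`. -/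
def lipOne : Set (ℕ → ℝ) := {f | ∀ x y : ℕ, |f x - f y| ≤ |(x : ℝ) - (y : ℝ)|}

/-- `g` solves the Stein equation of `PBD(a; 0, 1, b)` for the test function `f`, with the
convention `g(0) = g(1)` (the value `g(0)` does not enter the equation). -/
def IsSteinSolution (a b : ℝ) (f g : ℕ → ℝ) : Prop :=
  (∀ i : ℕ, a * g (i + 1) - deathRate b i * g i = f i - pbdExp a b f) ∧ g 0 = g 1

/-- The supremum norm over `{0, 1, 2, …}`, as an extended real (`⊤` if `u` is unbounded). -/
noncomputable def supNorm (u : ℕ → ℝ) : EReal := ⨆ i : ℕ, ((|u i| : ℝ) : EReal)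

/-!
Write `β_i` for the death rates, `m` for the mean of `π`, and `g_f` for the Stein solution of the
test function `f`. Differencing the Stein equation shows that `g_f`, `Δ g_f` and `Δ² g_f` satisfy
equations for the birth-death generator with birth rate `a` and death rate `β_j` at the site
`j + 1`, killed at the rates `1 + 2bj`, `2(1 + 2bj)` and `3(1 + 2bj)`; the sources are the
differences of `f` and lower order differences of `g_f`. As `g_f` is bounded
(`boundedSeq_steinSol`), these equations are governed by a maximum principle
(`nonneg_of_shiftGen_le`).

For the solution `u` of the linear test function `-n` it yields `u ≥ 0`, `Δu ≤ 0`, `Δ²u ≥ 0` and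
`Δ³u ≤ 0`. Hence `u`, `-Δu` and `Δ²u` are largest at the site `1`, where they are explicit in terms
of `m`, and moment inequalities for `π` bound them. The maximum principle also gives `|g_f| ≤ u`,
which is the bound for the solutions.

For the differences, the sign of `Δ g_h(i)` or `Δ² g_h(i)` is found by cutting `h` at `i`: to the
right (left) of the support of a test function, its solution is a multiple of a fundamental solution
`rightSol` (`leftSol`), which is monotone and convex. This shows that `Δ g_f(i)` is largest for the
tent function `f(n) = -|n - i|` (`fwdDiff_steinSol_nonneg`) and `Δ² g_f(i)` for
`f(n) = -n + 2 · 1_{n > i}` (`fwdDiff2_steinSol_nonneg`). In the second case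
`Δ² g_f(i) = Δ²u(i) + 2 Δ² g_{1_{n > i}}(i)`, and the last difference is at most `1 / a` because
`leftSol` is convex. In the first case `Δ² f` is concentrated at one site, and the maximum principle
compares `Δ g_f` with `-Δu + χ` for a supersolution `χ` with a source of strength `2` at that site:
the constant `1 / (1 + b)`, or a function with the values `1 / √(ab)` up to the site and a smaller
constant after it (`abs_fwdDiff_steinSol_le`).
-/

/-! ### The death rates and the equilibrium distribution -/

theorem deathRate_zero (b : ℝ) : deathRate b 0 = 0 := by simp [deathRate]

theorem deathRate_succ (b : ℝ) (i : ℕ) :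
    deathRate b (i + 1) = deathRate b i + (1 + 2 * b * i) := by
  simp only [deathRate]; push_cast; ring

theorem le_deathRate {b : ℝ} (hb : 0 ≤ b) (i : ℕ) : (i : ℝ) ≤ deathRate b i := by
  induction i with
  | zero => simp [deathRate]
  | succ n ih =>
    rw [deathRate_succ]; push_cast
    have : 0 ≤ 2 * b * n := by positivity
    linarith

theorem deathRate_nonneg {b : ℝ} (hb : 0 ≤ b) (i : ℕ) : 0 ≤ deathRate b i :=
  (Nat.cast_nonneg i).trans (le_deathRate hb i)

theorem deathRate_succ_pos {b : ℝ} (hb : 0 ≤ b) (i : ℕ) : 0 < deathRate b (i + 1) :=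
  lt_of_lt_of_le (by positivity) (le_deathRate hb (i + 1))

theorem bdWeight_zero (α β : ℕ → ℝ) : bdWeight α β 0 = 1 := by simp [bdWeight]

theorem bdWeight_succ (α β : ℕ → ℝ) (n : ℕ) (h : β (n + 1) ≠ 0) :
    β (n + 1) * bdWeight α β (n + 1) = α n * bdWeight α β n := by
  rw [bdWeight, bdWeight, Finset.prod_range_succ, Finset.prod_Icc_succ_top (by omega)]
  by_cases h0 : ∏ i ∈ Finset.Icc 1 n, β i = 0
  · simp [h0]
  · field_simp

section Distribution

variable {a b : ℝ}

theorem pbd_weight_pos (ha : 0 < a) (hb : 0 ≤ b) (n : ℕ) :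
    0 < bdWeight (fun _ => a) (deathRate b) n := by
  rw [bdWeight]
  refine div_pos (Finset.prod_pos fun _ _ => ha) (Finset.prod_pos fun i hi => ?_)
  obtain ⟨k, rfl⟩ := Nat.exists_eq_add_of_le' (Finset.mem_Icc.1 hi).1
  exact deathRate_succ_pos hb k

theorem pbd_weight_le (ha : 0 < a) (hb : 0 ≤ b) (n : ℕ) :
    bdWeight (fun _ => a) (deathRate b) n ≤ a ^ n / n.factorial := by
  induction n with
  | zero => simp [bdWeight_zero]
  | succ n ih =>
    have h1 := bdWeight_succ (fun _ => a) (deathRate b) n (deathRate_succ_pos hb n).ne'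
    have h2 := mul_le_mul_of_nonneg_right (le_deathRate hb (n + 1))
      (pbd_weight_pos ha hb (n + 1)).le
    have h3 := mul_le_mul_of_nonneg_left ih ha.le
    have h4 : a ^ (n + 1) / ((n + 1).factorial : ℝ) =
        a * (a ^ n / n.factorial) / ((n + 1 : ℕ) : ℝ) := by
      rw [Nat.factorial_succ]; push_cast; field_simp; ring
    rw [h4, le_div_iff₀ (by positivity)]
    linarith

theorem summable_pbd_weight (ha : 0 < a) (hb : 0 ≤ b) :
    Summable (bdWeight (fun _ => a) (deathRate b)) :=
  Summable.of_nonneg_of_le (fun n => (pbd_weight_pos ha hb n).le) (pbd_weight_le ha hb)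
    (Real.summable_pow_div_factorial a)

theorem pbd_eq (ha : 0 < a) (hb : 0 ≤ b) (n : ℕ) :
    pbd a b n = bdWeight (fun _ => a) (deathRate b) n *
      (∑' j, bdWeight (fun _ => a) (deathRate b) j)⁻¹ := by
  rw [pbd, bdProb, (summable_pbd_weight ha hb).tsum_eq_zero_add, bdWeight_zero]

theorem pbd_weight_tsum_pos (ha : 0 < a) (hb : 0 ≤ b) :
    0 < ∑' j, bdWeight (fun _ => a) (deathRate b) j :=
  (summable_pbd_weight ha hb).tsum_pos (fun n => (pbd_weight_pos ha hb n).le) 0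
    (pbd_weight_pos ha hb 0)

theorem pbd_pos (ha : 0 < a) (hb : 0 ≤ b) (n : ℕ) : 0 < pbd a b n := by
  rw [pbd_eq ha hb]
  exact mul_pos (pbd_weight_pos ha hb n) (inv_pos.2 (pbd_weight_tsum_pos ha hb))

theorem hasSum_pbd (ha : 0 < a) (hb : 0 ≤ b) : HasSum (pbd a b) 1 := by
  have h := (summable_pbd_weight ha hb).hasSum.mul_right
    (∑' j, bdWeight (fun _ => a) (deathRate b) j)⁻¹
  rw [mul_inv_cancel₀ (pbd_weight_tsum_pos ha hb).ne'] at h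
  exact h.congr_fun (fun n => pbd_eq ha hb n)

/-- Detailed balance: in equilibrium the flow from `n` to `n + 1` equals the reverse flow. -/
theorem pbd_balance (ha : 0 < a) (hb : 0 ≤ b) (n : ℕ) :
    deathRate b (n + 1) * pbd a b (n + 1) = a * pbd a b n := by
  rw [pbd_eq ha hb, pbd_eq ha hb, ← mul_assoc, ← mul_assoc,
    bdWeight_succ (fun _ => a) (deathRate b) n (deathRate_succ_pos hb n).ne']

theorem pbd_add_le (ha : 0 < a) (hb : 0 ≤ b) (n k : ℕ) :
    pbd a b (n + k) ≤ pbd a b n * (a ^ k / k.factorial) := by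
  induction k with
  | zero => simp
  | succ k ih =>
    have h1 := pbd_balance ha hb (n + k)
    have h0 : ((k + 1 : ℕ) : ℝ) ≤ deathRate b (n + k + 1) :=
      le_trans (by push_cast; linarith [(Nat.cast_nonneg n : (0 : ℝ) ≤ n)])
        (le_deathRate hb (n + k + 1))
    have h2 := mul_le_mul_of_nonneg_right h0 (pbd_pos ha hb (n + k + 1)).le
    have h3 := mul_le_mul_of_nonneg_left ih ha.le
    have h4 : pbd a b n * (a ^ (k + 1) / ((k + 1).factorial : ℝ)) =
        a * (pbd a b n * (a ^ k / k.factorial)) / ((k + 1 : ℕ) : ℝ) := by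
      rw [Nat.factorial_succ]; push_cast; field_simp; ring
    rw [h4, le_div_iff₀ (by positivity), ← add_assoc]
    linarith

theorem tsum_pbd_add_le (ha : 0 < a) (hb : 0 ≤ b) (n : ℕ) :
    ∑' k, pbd a b (n + k) ≤ pbd a b n * Real.exp a := by
  have h := NormedSpace.expSeries_div_hasSum_exp (𝔸 := ℝ) a
  rw [← Real.exp_eq_exp_ℝ] at h
  have h2 := h.mul_left (pbd a b n)
  refine le_of_le_of_eq (Summable.tsum_le_tsum (pbd_add_le ha hb n) ?_ h2.summable) h2.tsum_eq
  exact Summable.of_nonneg_of_le (fun k => (pbd_pos ha hb _).le) (pbd_add_le ha hb n) h2.summable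

/-! ### Functions of linear growth and their expectations -/

/-- The functions on `ℕ` of at most linear growth: a vector space that contains the Lipschitz
functions and every test function that occurs below. -/
def LinearGrowth (f : ℕ → ℝ) : Prop := ∃ C, ∀ n : ℕ, |f n| ≤ C * (n + 1)

namespace LinearGrowth

variable {f g : ℕ → ℝ}

theorem add (hf : LinearGrowth f) (hg : LinearGrowth g) : LinearGrowth (fun n => f n + g n) := by
  obtain ⟨C, hC⟩ := hf
  obtain ⟨D, hD⟩ := hg
  exact ⟨C + D, fun n => (abs_add_le _ _).trans (by linarith [hC n, hD n])⟩

theorem const_mul (c : ℝ) (hf : LinearGrowth f) : LinearGrowth (fun n => c * f n) := by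
  obtain ⟨C, hC⟩ := hf
  refine ⟨|c| * C, fun n => ?_⟩
  rw [abs_mul, mul_assoc]
  exact mul_le_mul_of_nonneg_left (hC n) (abs_nonneg c)

theorem const (c : ℝ) : LinearGrowth (fun _ => c) :=
  ⟨|c|, fun n => le_mul_of_one_le_right (abs_nonneg c)
    (by linarith [(Nat.cast_nonneg n : (0 : ℝ) ≤ n)])⟩

theorem of_abs_le (hg : LinearGrowth g) (h : ∀ n, |f n| ≤ |g n|) : LinearGrowth f := by
  obtain ⟨C, hC⟩ := hg
  exact ⟨C, fun n => (h n).trans (hC n)⟩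

theorem natCast : LinearGrowth (fun n => (n : ℝ)) :=
  ⟨1, fun n => by rw [abs_of_nonneg (Nat.cast_nonneg n)]; linarith⟩

theorem neg (hf : LinearGrowth f) : LinearGrowth (fun n => -f n) :=
  hf.of_abs_le fun _ => (abs_neg _).le

theorem sub (hf : LinearGrowth f) (hg : LinearGrowth g) : LinearGrowth (fun n => f n - g n) := by
  simpa only [sub_eq_add_neg] using hf.add hg.neg

end LinearGrowth

theorem lipOne_abs_sub_le {f : ℕ → ℝ} (hf : f ∈ lipOne) (n : ℕ) : |f n - f 0| ≤ n := by
  have h := hf n 0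
  rwa [Nat.cast_zero, sub_zero, abs_of_nonneg (Nat.cast_nonneg n : (0 : ℝ) ≤ n)] at h

theorem LinearGrowth.of_lipOne {f : ℕ → ℝ} (hf : f ∈ lipOne) : LinearGrowth f := by
  have h1 : LinearGrowth (fun n => f n - f 0) := LinearGrowth.natCast.of_abs_le fun n => by
    rw [abs_of_nonneg (Nat.cast_nonneg n : (0 : ℝ) ≤ n)]; exact lipOne_abs_sub_le hf n
  simpa using h1.add (LinearGrowth.const (f 0))

theorem neg_mem_lipOne {f : ℕ → ℝ} (hf : f ∈ lipOne) : (fun n => -f n) ∈ lipOne := by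
  intro x y
  rw [show -f x - -f y = -(f x - f y) by ring, abs_neg]
  exact hf x y

theorem summable_natCast_mul_pbd (ha : 0 < a) (hb : 0 ≤ b) :
    Summable (fun n : ℕ => (n : ℝ) * pbd a b n) := by
  rw [← summable_nat_add_iff 1]
  refine Summable.of_nonneg_of_le (fun n => mul_nonneg (Nat.cast_nonneg _) (pbd_pos ha hb _).le)
    (fun n => ?_) ((hasSum_pbd ha hb).summable.mul_left a)
  rw [← pbd_balance ha hb n]
  exact mul_le_mul_of_nonneg_right (le_deathRate hb (n + 1)) (pbd_pos ha hb _).le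

theorem LinearGrowth.summable_abs (ha : 0 < a) (hb : 0 ≤ b) {f : ℕ → ℝ} (hf : LinearGrowth f) :
    Summable (fun n => |f n| * pbd a b n) := by
  obtain ⟨C, hC⟩ := hf
  refine Summable.of_nonneg_of_le (fun n => mul_nonneg (abs_nonneg _) (pbd_pos ha hb _).le)
    (fun n => mul_le_mul_of_nonneg_right (hC n) (pbd_pos ha hb n).le) ?_
  have h := ((summable_natCast_mul_pbd ha hb).add (hasSum_pbd ha hb).summable).mul_left C
  exact h.congr fun n => by ring

theorem LinearGrowth.summable (ha : 0 < a) (hb : 0 ≤ b) {f : ℕ → ℝ} (hf : LinearGrowth f) :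
    Summable (fun n => f n * pbd a b n) := by
  refine Summable.of_abs ((hf.summable_abs ha hb).congr fun n => ?_)
  rw [abs_mul, abs_of_pos (pbd_pos ha hb n)]

theorem pbdExp_add (ha : 0 < a) (hb : 0 ≤ b) {f g : ℕ → ℝ} (hf : LinearGrowth f)
    (hg : LinearGrowth g) :
    pbdExp a b (fun n => f n + g n) = pbdExp a b f + pbdExp a b g := by
  simp only [pbdExp, add_mul]
  exact (hf.summable ha hb).tsum_add (hg.summable ha hb)

theorem pbdExp_const_mul (c : ℝ) (f : ℕ → ℝ) :
    pbdExp a b (fun n => c * f n) = c * pbdExp a b f := by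
  simp only [pbdExp, mul_assoc]
  exact tsum_mul_left

theorem pbdExp_const (ha : 0 < a) (hb : 0 ≤ b) (c : ℝ) : pbdExp a b (fun _ => c) = c := by
  simp only [pbdExp]
  rw [tsum_mul_left, (hasSum_pbd ha hb).tsum_eq, mul_one]

theorem pbdExp_mono (ha : 0 < a) (hb : 0 ≤ b) {f g : ℕ → ℝ} (hf : LinearGrowth f)
    (hg : LinearGrowth g) (h : ∀ n, f n ≤ g n) : pbdExp a b f ≤ pbdExp a b g :=
  Summable.tsum_le_tsum (fun n => mul_le_mul_of_nonneg_right (h n) (pbd_pos ha hb n).le)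
    (hf.summable ha hb) (hg.summable ha hb)

theorem pbdExp_nonneg (ha : 0 < a) (hb : 0 ≤ b) {f : ℕ → ℝ} (h : ∀ n, 0 ≤ f n) :
    0 ≤ pbdExp a b f :=
  tsum_nonneg fun n => mul_nonneg (h n) (pbd_pos ha hb n).le

theorem pbdExp_indicator_zero : pbdExp a b (fun n => if n = 0 then 1 else 0) = pbd a b 0 := by
  rw [pbdExp, tsum_eq_single 0 (fun n hn => by simp [hn])]
  simp

/-! ### Moments of the equilibrium distribution -/

/-- The mean of the equilibrium distribution. -/
noncomputable def pbdMean (a b : ℝ) : ℝ := pbdExp a b (fun n => (n : ℝ))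

theorem summable_factorialMoment (ha : 0 < a) (hb : 0 ≤ b) :
    Summable (fun n : ℕ => (n : ℝ) * (n - 1) * pbd a b n) := by
  rw [← summable_nat_add_iff 1]
  refine Summable.of_nonneg_of_le (fun n => ?_) (fun n => ?_)
    ((summable_natCast_mul_pbd ha hb).mul_left a)
  · have := (pbd_pos ha hb (n + 1)).le
    push_cast; rw [add_sub_cancel_right]; positivity
  · have h := mul_le_mul_of_nonneg_right (le_deathRate hb (n + 1)) (pbd_pos ha hb (n + 1)).le
    rw [pbd_balance ha hb n] at h
    have h2 := mul_le_mul_of_nonneg_left h (Nat.cast_nonneg n : (0 : ℝ) ≤ n)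
    push_cast at h2 ⊢
    linarith

/-- The second factorial moment of the equilibrium distribution. -/
noncomputable def pbdFactorialMoment (a b : ℝ) : ℝ := pbdExp a b (fun n => (n : ℝ) * (n - 1))

/-- In equilibrium the mean death rate equals the birth rate. -/
theorem mean_add_factorialMoment (ha : 0 < a) (hb : 0 ≤ b) :
    pbdMean a b + b * pbdFactorialMoment a b = a := by
  have h1 := (summable_natCast_mul_pbd ha hb).hasSum.add
    ((summable_factorialMoment ha hb).hasSum.mul_left b)
  have h2 : HasSum (fun n => deathRate b n * pbd a b n) (a * 1) := by
    rw [← hasSum_nat_add_iff' 1]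
    simpa [deathRate_zero, pbd_balance ha hb] using (hasSum_pbd ha hb).mul_left a
  rw [mul_one] at h2
  refine HasSum.unique (h1.congr_fun fun n => ?_) h2 
  simp only [deathRate]; ring

theorem mean_nonneg (ha : 0 < a) (hb : 0 ≤ b) : 0 ≤ pbdMean a b :=
  pbdExp_nonneg ha hb fun n => Nat.cast_nonneg n

theorem factorialMoment_nonneg (ha : 0 < a) (hb : 0 ≤ b) : 0 ≤ pbdFactorialMoment a b :=
  pbdExp_nonneg ha hb fun n => by
    rcases Nat.eq_zero_or_pos n with rfl | h
    · simp
    · have : (1 : ℝ) ≤ n := by exact_mod_cast h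
      exact mul_nonneg (by linarith) (by linarith)

theorem mean_le (ha : 0 < a) (hb : 0 ≤ b) : pbdMean a b ≤ a := by
  have h := mean_add_factorialMoment ha hb
  have h2 := mul_nonneg hb (factorialMoment_nonneg ha hb)
  linarith

/-- Detailed balance turns the second factorial moment into `a E[X / (1 + b X)]`; on the positive
integers the convex function `1 / (1 + b x)` lies above its chord through `x = 1` and `x = 2`. -/
theorem factorialMoment_ge (ha : 0 < a) (hb : 0 ≤ b) :
    a * ((1 + 2 * b) * pbdMean a b - b * pbdFactorialMoment a b) ≤
      (1 + b) * (1 + 2 * b) * pbdFactorialMoment a b := by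
  have hq := (summable_factorialMoment ha hb).hasSum
  have h1 := (((summable_natCast_mul_pbd ha hb).hasSum.mul_left (1 + 2 * b)).sub
    (hq.mul_left b)).mul_left a
  have h2 := (hq.mul_left ((1 + b) * (1 + 2 * b)))
  rw [← hasSum_nat_add_iff' 1] at h2
  simp only [Finset.range_one, Finset.sum_singleton, Nat.cast_zero, zero_mul, mul_zero,
    sub_zero] at h2
  refine hasSum_le (fun n => ?_) h1 h2
  have hbal := pbd_balance ha hb n
  have hp := (pbd_pos ha hb (n + 1)).le
  rcases Nat.eq_zero_or_pos n with rfl | hn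
  · simp
  obtain ⟨k, rfl⟩ := Nat.exists_eq_add_of_le' hn
  have e : a * ((1 + 2 * b) * (((k + 1 : ℕ) : ℝ) * pbd a b (k + 1)) -
      b * (((k + 1 : ℕ) : ℝ) * (((k + 1 : ℕ) : ℝ) - 1) * pbd a b (k + 1))) =
      ((1 + 2 * b) * (k + 1) - b * ((k + 1) * k)) * (a * pbd a b (k + 1)) := by
    push_cast; ring
  rw [e, ← hbal]
  simp only [deathRate]
  push_cast
  -- the gap between `1 / (1 + b x)` and its chord, up to positive factors, at `x = k + 1`
  have key : 0 ≤ b ^ 2 * ((k : ℝ) * (k - 1)) := by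
    refine mul_nonneg (sq_nonneg b) ?_
    rcases Nat.eq_zero_or_pos k with rfl | h
    · simp
    · have : (1 : ℝ) ≤ k := by exact_mod_cast h
      exact mul_nonneg (by linarith) (by linarith)
  have k2 : 0 ≤ ((k : ℝ) + 1) * (k + 2) * pbd a b (k + 1 + 1) * (b ^ 2 * ((k : ℝ) * (k - 1))) := by
    positivity
  nlinarith [k2]

theorem mean_mul_le (ha : 0 < a) (hb : 0 ≤ b) :
    pbdMean a b * (a + 2 * b + 2 + 2 * a * b) ≤ a * (a + 2 * b + 2) := by
  have h1 := mean_add_factorialMoment ha hb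
  have h2 := factorialMoment_ge ha hb
  have h3 := factorialMoment_nonneg ha hb
  set m := pbdMean a b
  set q := pbdFactorialMoment a b
  have hm : m = a - b * q := by linarith
  rw [hm] at h2 ⊢
  -- the lower bound for the factorial moment that the claim amounts to
  have h4 : 2 * a ^ 2 ≤ q * (a + 2 * b + 2 + 2 * a * b) := by
    have h5 : 0 ≤ a * q := mul_nonneg ha.le h3
    have h6 : (1 + 2 * b) * (2 * a ^ 2) ≤ (1 + 2 * b) * (q * (a + 2 * b + 2 + 2 * a * b)) := by
      nlinarith
    exact le_of_mul_le_mul_left h6 (by linarith)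
  nlinarith

/-- Nonnegativity of the variance. -/
theorem mean_sq_le (ha : 0 < a) (hb : 0 ≤ b) :
    b * pbdMean a b ^ 2 + (1 - b) * pbdMean a b ≤ a := by
  have h1 := mean_add_factorialMoment ha hb
  set m := pbdMean a b with hm
  have hs := (((summable_factorialMoment ha hb).hasSum).add
    (((summable_natCast_mul_pbd ha hb).hasSum.mul_left (1 - 2 * m)))).add
    ((hasSum_pbd ha hb).mul_left (m ^ 2))
  have h2 : 0 ≤ pbdFactorialMoment a b + (1 - 2 * m) * m + m ^ 2 * 1 := by
    refine hasSum_le (fun n => ?_) hasSum_zero hs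
    have : (n : ℝ) * (n - 1) * pbd a b n + (1 - 2 * m) * (n * pbd a b n) + m ^ 2 * pbd a b n =
      ((n : ℝ) - m) ^ 2 * pbd a b n := by ring
    rw [this]
    exact mul_nonneg (sq_nonneg _) (pbd_pos ha hb n).le
  nlinarith

theorem pbd_one (ha : 0 < a) (hb : 0 ≤ b) : pbd a b 1 = a * pbd a b 0 := by
  have h := pbd_balance ha hb 0
  simpa [deathRate] using h

/-- This says that the first three probabilities sum to at most one. -/
theorem pbd_zero_mul_le (ha : 0 < a) (hb : 0 ≤ b) :
    pbd a b 0 * (a ^ 2 + 2 * a + 2 + 2 * b * (a + 1)) ≤ 2 * (1 + b) := by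
  have h1 := pbd_one ha hb
  have h2 := pbd_balance ha hb 1
  have h3 := sum_le_hasSum (Finset.range 3) (fun n _ => (pbd_pos ha hb n).le) (hasSum_pbd ha hb)
  simp only [Finset.sum_range_succ, Finset.range_zero, Finset.sum_empty] at h3
  have h4 : deathRate b (1 + 1) = 2 * (1 + b) := by simp only [deathRate]; push_cast; ring
  rw [h4, h1] at h2
  rw [h1] at h3
  norm_num at h2
  nlinarith

/-- The mean is at least `P(X ≥ 1) + P(X ≥ 2)`. -/
theorem mean_ge (ha : 0 < a) (hb : 0 ≤ b) : 2 - (2 + a) * pbd a b 0 ≤ pbdMean a b := by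
  have h1 := ((hasSum_pbd ha hb).mul_left 2).sub
    ((hasSum_ite_eq 0 (2 * pbd a b 0)).add (hasSum_ite_eq 1 (pbd a b 1)))
  have h2 := hasSum_le (fun n => ?_) h1 (summable_natCast_mul_pbd ha hb).hasSum
  · rw [pbd_one ha hb] at h2
    refine le_trans (le_of_eq ?_) h2
    ring
  · have hp := (pbd_pos ha hb n).le
    rcases n with _ | _ | n
    · simp
    · simp; linarith
    · simp only [Nat.add_eq_zero_iff, one_ne_zero, and_false, if_false]
      rw [if_neg (by omega)]
      have : (2 : ℝ) ≤ ((n + 1 + 1 : ℕ) : ℝ) := by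
        push_cast; linarith [(Nat.cast_nonneg n : (0 : ℝ) ≤ n)]
      nlinarith

theorem one_sub_pbd_zero_le (ha : 0 < a) (hb : 0 ≤ b) : 1 - pbd a b 0 ≤ a := by
  have h1 : pbdExp a b (fun n => 1 + -1 * (if n = 0 then 1 else 0)) ≤ pbdMean a b := by
    refine Summable.tsum_le_tsum (fun n => mul_le_mul_of_nonneg_right ?_ (pbd_pos ha hb n).le)
      (((LinearGrowth.const 1).add (((LinearGrowth.const 1).of_abs_le fun n => ?_).const_mul
        (-1))).summable ha hb) (summable_natCast_mul_pbd ha hb)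
    · rcases n with _ | n
      · simp
      · simp
    · split_ifs <;> simp
  rw [pbdExp_add ha hb (LinearGrowth.const 1) (((LinearGrowth.const 1).of_abs_le fun n => by
    split_ifs <;> simp).const_mul (-1)), pbdExp_const ha hb, pbdExp_const_mul,
    pbdExp_indicator_zero] at h1
  linarith [mean_le ha hb]

end Distribution

/-! ### The maximum principle for the killed birth-death generator -/

/-- Bounded real sequences. -/
def BoundedSeq (ψ : ℕ → ℝ) : Prop := ∃ K, ∀ j, |ψ j| ≤ K

namespace BoundedSeq

variable {φ ψ : ℕ → ℝ}

theorem add (hφ : BoundedSeq φ) (hψ : BoundedSeq ψ) : BoundedSeq (fun j => φ j + ψ j) := by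
  obtain ⟨K, hK⟩ := hφ
  obtain ⟨M, hM⟩ := hψ
  exact ⟨K + M, fun j => (abs_add_le _ _).trans (add_le_add (hK j) (hM j))⟩

theorem const_mul (c : ℝ) (hψ : BoundedSeq ψ) : BoundedSeq (fun j => c * ψ j) := by
  obtain ⟨K, hK⟩ := hψ
  exact ⟨|c| * K, fun j => by
    rw [abs_mul]; exact mul_le_mul_of_nonneg_left (hK j) (abs_nonneg c)⟩

theorem neg (hψ : BoundedSeq ψ) : BoundedSeq (fun j => -ψ j) := by
  obtain ⟨K, hK⟩ := hψ
  exact ⟨K, fun j => by rw [abs_neg]; exact hK j⟩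

theorem sub (hφ : BoundedSeq φ) (hψ : BoundedSeq ψ) : BoundedSeq (fun j => φ j - ψ j) := by
  simpa only [sub_eq_add_neg] using hφ.add hψ.neg

theorem fwdDiff (hψ : BoundedSeq ψ) : BoundedSeq (fwdDiff 1 ψ) := by
  obtain ⟨K, hK⟩ := hψ
  exact BoundedSeq.sub (φ := fun j => ψ (j + 1)) ⟨K, fun j => hK (j + 1)⟩ ⟨K, hK⟩

end BoundedSeq

/-- The birth-death generator with birth rate `a` and death rates `β_j`, moved one step to the
right: at the site `j + 1` the process dies at rate `β_j`, so that the site `1` has no death and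
the value `ψ 0` does not matter. -/
def shiftGen (a b : ℝ) (ψ : ℕ → ℝ) (j : ℕ) : ℝ :=
  a * (ψ (j + 2) - ψ (j + 1)) + deathRate b j * (ψ j - ψ (j + 1))

section MaximumPrinciple

variable {a b : ℝ}

/-- Maximum principle: a bounded supersolution for a generator killed at rates at least one is
nonnegative. Adding a small multiple of `j + a` makes the minimum attained. -/
theorem nonneg_of_shiftGen_le (ha : 0 < a) (hb : 0 ≤ b) {ψ κ : ℕ → ℝ} (hψ : BoundedSeq ψ)
    (hκ : ∀ j, 1 ≤ κ j)
    (h : ∀ j, 0 ≤ ψ (j + 1) ∨ shiftGen a b ψ j ≤ κ j * ψ (j + 1)) (n : ℕ) : 0 ≤ ψ (n + 1) := by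
  by_contra! hneg
  obtain ⟨K, hK⟩ := hψ
  obtain ⟨ε, hε, hεn⟩ : ∃ ε > 0, ψ (n + 1) + ε * (n + 1 + a) < 0 := by
    have hp : 0 < (n : ℝ) + 1 + a := by positivity
    refine ⟨-ψ (n + 1) / (2 * (n + 1 + a)), div_pos (neg_pos.2 hneg) (by positivity), ?_⟩
    have : -ψ (n + 1) / (2 * (n + 1 + a)) * (n + 1 + a) = -ψ (n + 1) / 2 := by field_simp
    rw [this]; linarith
  have htend : Filter.Tendsto (fun j : ℕ => ψ (j + 1) + ε * (j + 1 + a)) Filter.cofinite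
      Filter.atTop := by
    rw [Nat.cofinite_eq_atTop]
    refine Filter.tendsto_atTop_mono (f := fun j : ℕ => -K + ε * j) (fun j => ?_)
      (Filter.tendsto_atTop_add_const_left _ _
        (tendsto_natCast_atTop_atTop.const_mul_atTop hε))
    have h1 := neg_le_of_abs_le (hK (j + 1))
    have h2 : 0 ≤ ε * (1 + a) := by positivity
    linarith
  -- at a minimizer `j` of the perturbed function the equation fails
  obtain ⟨j, hj⟩ := htend.exists_forall_le
  have hjn := hj n
  have hjs := hj (j + 1)
  push_cast at hjs
  have hpos : 0 < ε * ((j : ℝ) + 1 + a) := by positivity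
  rcases h j with h0 | h0
  · linarith
  have hbirth : -(a * ε) ≤ a * (ψ (j + 2) - ψ (j + 1)) := by
    have : -ε ≤ ψ (j + 2) - ψ (j + 1) := by linarith
    linarith [mul_le_mul_of_nonneg_left this ha.le]
  have hd : 0 ≤ deathRate b j * (ψ j - ψ (j + 1)) := by
    rcases j with _ | k
    · simp [deathRate_zero]
    · have := hj k
      push_cast at this
      exact mul_nonneg (deathRate_nonneg hb (k + 1)) (by linarith)
  have hkill : κ j * ψ (j + 1) < -(ε * ((j : ℝ) + 1 + a)) := by
    have h1 : ψ (j + 1) < -(ε * ((j : ℝ) + 1 + a)) := by linarith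
    have h2 := mul_nonneg (sub_nonneg.2 (hκ j)) (show 0 ≤ -ψ (j + 1) by linarith)
    linarith
  have hj0 : 0 ≤ ε * ((j : ℝ) + 1) := by positivity
  simp only [shiftGen] at h0
  linarith

/-- Differencing an equation for the shifted generator raises the killing rate by a unit and
produces a source proportional to the undifferenced function. -/
theorem shiftGen_fwdDiff {g R : ℕ → ℝ} {c : ℝ} {j : ℕ}
    (h : shiftGen a b g j = c * (1 + 2 * b * j) * g (j + 1) + R j)
    (h' : shiftGen a b g (j + 1) = c * (1 + 2 * b * (j + 1)) * g (j + 2) + R (j + 1)) :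
    shiftGen a b (fwdDiff 1 g) j = (c + 1) * (1 + 2 * b * j) * fwdDiff 1 g (j + 1) +
      (2 * b * c * g (j + 2) + (R (j + 1) - R j)) := by
  simp only [shiftGen, fwdDiff, deathRate_succ] at *
  linear_combination h' - h

/-- The difference of the Stein equation. -/
theorem shiftGen_of_stein {g F : ℕ → ℝ} {j : ℕ}
    (h : a * g (j + 1) - deathRate b j * g j = F j)
    (h' : a * g (j + 2) - deathRate b (j + 1) * g (j + 1) = F (j + 1)) :
    shiftGen a b g j = 1 * (1 + 2 * b * j) * g (j + 1) + (F (j + 1) - F j) := by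
  simp only [shiftGen, deathRate_succ] at *
  linear_combination h' - h

theorem one_le_killing (hb : 0 ≤ b) {c : ℝ} (hc : 1 ≤ c) (j : ℕ) :
    1 ≤ c * (1 + 2 * b * j) := by
  have h : (0 : ℝ) ≤ 2 * b * j := by positivity
  nlinarith

/-! ### Solutions of the Stein equation -/

/-- The solution of `a g(i+1) - β_i g(i) = F(i)` with `g(0) = g(1)`, by forward recursion. -/
noncomputable def recSol (a b : ℝ) (F : ℕ → ℝ) : ℕ → ℝ
  | 0 => F 0 / a
  | j + 1 => (F j + deathRate b j * recSol a b F j) / a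

theorem recSol_eq (ha : 0 < a) (F : ℕ → ℝ) (i : ℕ) :
    a * recSol a b F (i + 1) - deathRate b i * recSol a b F i = F i := by
  rw [recSol]; field_simp; ring

theorem recSol_zero (F : ℕ → ℝ) : recSol a b F 0 = recSol a b F 1 := by
  simp [recSol, deathRate_zero]

theorem eq_recSol (ha : 0 < a) {F g : ℕ → ℝ} {n : ℕ}
    (h : ∀ i ≤ n, a * g (i + 1) - deathRate b i * g i = F i) :
    ∀ i ≤ n, g (i + 1) = recSol a b F (i + 1) := by
  intro i
  induction i with
  | zero =>
    intro hi
    have h1 := h 0 hi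
    have h2 := recSol_eq (b := b) ha F 0
    rw [deathRate_zero, zero_mul, sub_zero] at h1 h2
    exact mul_left_cancel₀ ha.ne' (h1.trans h2.symm)
  | succ i ih =>
    intro hi
    have h1 := h (i + 1) hi
    have h2 := recSol_eq (b := b) ha F (i + 1)
    rw [ih (by omega)] at h1
    exact mul_left_cancel₀ ha.ne' (by linarith)

theorem recSol_add (F G : ℕ → ℝ) (i : ℕ) :
    recSol a b (fun n => F n + G n) i = recSol a b F i + recSol a b G i := by
  induction i with
  | zero => simp only [recSol]; ring
  | succ i ih => simp only [recSol, ih]; ring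

theorem recSol_const_mul (c : ℝ) (F : ℕ → ℝ) (i : ℕ) :
    recSol a b (fun n => c * F n) i = c * recSol a b F i := by
  induction i with
  | zero => simp only [recSol]; ring
  | succ i ih => simp only [recSol, ih]; ring

/-- The solution `g` of the Stein equation with `g(0) = g(1)`. -/
noncomputable def steinSol (a b : ℝ) (f : ℕ → ℝ) : ℕ → ℝ :=
  recSol a b (fun i => f i - pbdExp a b f)

theorem steinSol_eq (ha : 0 < a) (f : ℕ → ℝ) (i : ℕ) :
    a * steinSol a b f (i + 1) - deathRate b i * steinSol a b f i = f i - pbdExp a b f :=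
  recSol_eq ha _ i

theorem isSteinSolution_steinSol (ha : 0 < a) (f : ℕ → ℝ) :
    IsSteinSolution a b f (steinSol a b f) :=
  ⟨steinSol_eq ha f, recSol_zero _⟩

theorem IsSteinSolution.eq_steinSol (ha : 0 < a) {f g : ℕ → ℝ} (h : IsSteinSolution a b f g) :
    g = steinSol a b f := by
  have h1 (i : ℕ) : g (i + 1) = steinSol a b f (i + 1) :=
    eq_recSol ha (fun j _ => h.1 j) i le_rfl
  funext i
  cases i with
  | zero => rw [h.2, h1 0]; exact (recSol_zero _).symm
  | succ i => exact h1 i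

theorem steinSol_add (ha : 0 < a) (hb : 0 ≤ b) {f g : ℕ → ℝ} (hf : LinearGrowth f)
    (hg : LinearGrowth g) (i : ℕ) :
    steinSol a b (fun n => f n + g n) i = steinSol a b f i + steinSol a b g i := by
  simp only [steinSol]
  rw [pbdExp_add ha hb hf hg, ← recSol_add]
  congr 1; funext n; ring

theorem steinSol_const_mul (c : ℝ) (f : ℕ → ℝ) (i : ℕ) :
    steinSol a b (fun n => c * f n) i = c * steinSol a b f i := by
  simp only [steinSol]
  rw [pbdExp_const_mul, ← recSol_const_mul]
  congr 1; funext n; ring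

theorem steinSol_neg (f : ℕ → ℝ) (i : ℕ) :
    steinSol a b (fun n => -f n) i = -steinSol a b f i := by
  simpa using steinSol_const_mul (a := a) (b := b) (-1) f i

theorem steinSol_sub (ha : 0 < a) (hb : 0 ≤ b) {f g : ℕ → ℝ} (hf : LinearGrowth f)
    (hg : LinearGrowth g) (i : ℕ) :
    steinSol a b (fun n => f n - g n) i = steinSol a b f i - steinSol a b g i := by
  simp only [sub_eq_add_neg]
  rw [steinSol_add ha hb hf hg.neg, steinSol_neg]

theorem steinSol_add_const (ha : 0 < a) (hb : 0 ≤ b) {f : ℕ → ℝ} (hf : LinearGrowth f) (c : ℝ)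
    (i : ℕ) : steinSol a b (fun n => f n + c) i = steinSol a b f i := by
  simp only [steinSol]
  rw [pbdExp_add ha hb hf (LinearGrowth.const c), pbdExp_const ha hb]
  congr 1; funext n; ring

theorem sum_mul_pbd_eq (ha : 0 < a) (hb : 0 ≤ b) (F : ℕ → ℝ) (n : ℕ) :
    a * pbd a b n * recSol a b F (n + 1) = ∑ j ∈ Finset.range (n + 1), F j * pbd a b j := by
  induction n with
  | zero =>
    have h := recSol_eq (b := b) ha F 0
    rw [deathRate_zero, zero_mul, sub_zero] at h
    simp only [zero_add, Finset.range_one, Finset.sum_singleton] at h ⊢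
    linear_combination (pbd a b 0) * h
  | succ n ih =>
    have h := recSol_eq (b := b) ha F (n + 1)
    have h2 := pbd_balance ha hb n
    rw [Finset.sum_range_succ, ← ih]
    linear_combination (pbd a b (n + 1)) * h + recSol a b F (n + 1) * h2

/-- The weighted partial sums of a centred function are minus its tail sums, which are of the
order of the equilibrium weights. -/
theorem boundedSeq_steinSol (ha : 0 < a) (hb : 0 ≤ b) {f : ℕ → ℝ} (hf : LinearGrowth f) :
    BoundedSeq (steinSol a b f) := by
  set F : ℕ → ℝ := fun i => f i - pbdExp a b f with hF
  have hFg : LinearGrowth F := hf.sub (LinearGrowth.const _)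
  have hsum := hFg.summable ha hb
  have hzero : ∑' j, F j * pbd a b j = 0 := by
    have h := pbdExp_add ha hb hf (LinearGrowth.const (-pbdExp a b f))
    rw [pbdExp_const ha hb, add_neg_cancel] at h
    simpa only [pbdExp, hF, sub_eq_add_neg] using h
  obtain ⟨C, hC⟩ := hFg
  have hC0 : 0 ≤ C := by
    have := (abs_nonneg _).trans (hC 0)
    simpa using this
  have main (n : ℕ) : |recSol a b F (n + 1)| ≤ 2 * C * Real.exp a := by
    have h1 := hsum.sum_add_tsum_nat_add (n + 1)
    rw [hzero, ← sum_mul_pbd_eq ha hb] at h1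
    have hs : Summable (fun k => pbd a b (n + k)) := by
      simpa only [add_comm] using (summable_nat_add_iff n).2 (hasSum_pbd ha hb).summable
    have h2 : ‖∑' k, F (k + (n + 1)) * pbd a b (k + (n + 1))‖ ≤
        2 * C * a * ∑' k, pbd a b (n + k) := by
      refine tsum_of_norm_bounded (hs.hasSum.mul_left (2 * C * a)) fun k => ?_
      have e : k + (n + 1) = n + k + 1 := by ring
      have hp := (pbd_pos ha hb (n + k + 1)).le
      rw [e, Real.norm_eq_abs, abs_mul, abs_of_nonneg hp]
      have h3 : |F (n + k + 1)| ≤ 2 * C * deathRate b (n + k + 1) := by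
        have h4 := le_deathRate hb (n + k + 1)
        have h5 := hC (n + k + 1)
        have h6 : (0 : ℝ) ≤ n + k := by positivity
        push_cast at h4 h5
        nlinarith
      calc |F (n + k + 1)| * pbd a b (n + k + 1)
          ≤ 2 * C * deathRate b (n + k + 1) * pbd a b (n + k + 1) :=
            mul_le_mul_of_nonneg_right h3 hp
        _ = 2 * C * a * pbd a b (n + k) := by
            rw [mul_assoc, pbd_balance ha hb]; ring
    have h3 := h2.trans (mul_le_mul_of_nonneg_left (tsum_pbd_add_le ha hb n)
      (show 0 ≤ 2 * C * a by positivity))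
    have hp := pbd_pos ha hb n
    have h4 : |a * pbd a b n * recSol a b F (n + 1)| ≤
        2 * C * a * (pbd a b n * Real.exp a) := by
      rw [eq_neg_of_add_eq_zero_left h1, abs_neg]
      exact h3
    rw [abs_mul, abs_of_pos (mul_pos ha hp)] at h4
    refine le_of_mul_le_mul_left (h4.trans (le_of_eq ?_)) (mul_pos ha hp)
    ring
  refine ⟨2 * C * Real.exp a, fun j => ?_⟩
  cases j with
  | zero => rw [(isSteinSolution_steinSol ha f).2]; exact main 0
  | succ n => exact main n

theorem fwdDiff_steinSol_one (ha : 0 < a) (f : ℕ → ℝ) :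
    a ^ 2 * fwdDiff 1 (steinSol a b f) 1 = a * (f 1 - f 0) + (f 0 - pbdExp a b f) := by
  have h0 := steinSol_eq (b := b) ha f 0
  have h1 := steinSol_eq (b := b) ha f 1
  have d : deathRate b 1 = 1 := by simp [deathRate]
  rw [d] at h1
  rw [deathRate_zero] at h0
  simp only [fwdDiff]
  linear_combination a * h1 + (1 - a) * h0

theorem shiftGen_steinSol (ha : 0 < a) (f : ℕ → ℝ) (j : ℕ) :
    shiftGen a b (steinSol a b f) j =
      1 * (1 + 2 * b * j) * steinSol a b f (j + 1) + (f (j + 1) - f j) := by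
  rw [shiftGen_of_stein (F := fun i => f i - pbdExp a b f) (steinSol_eq ha f j)
    (steinSol_eq ha f (j + 1))]
  ring

theorem shiftGen_fwdDiff_steinSol (ha : 0 < a) (f : ℕ → ℝ) (j : ℕ) :
    shiftGen a b (fwdDiff 1 (steinSol a b f)) j =
      2 * (1 + 2 * b * j) * fwdDiff 1 (steinSol a b f) (j + 1) +
        (2 * b * steinSol a b f (j + 2) + (f (j + 2) - 2 * f (j + 1) + f j)) := by
  have h' := shiftGen_steinSol (b := b) ha f (j + 1)
  push_cast at h'
  have h := shiftGen_fwdDiff (R := fun j => f (j + 1) - f j) (shiftGen_steinSol (b := b) ha f j) h'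
  rw [h]; ring

end MaximumPrinciple

/-! ### The solution for the linear test function -/

/-- The Stein solution for the test function `n ↦ -n`, the extremal one for the size of the
solutions. -/
noncomputable def linSol (a b : ℝ) : ℕ → ℝ := steinSol a b (fun n => -(n : ℝ))

section LinSol

variable {a b : ℝ}

theorem pbdExp_neg (f : ℕ → ℝ) : pbdExp a b (fun n => -f n) = -pbdExp a b f := by
  simpa using pbdExp_const_mul (a := a) (b := b) (-1) f

theorem steinSol_one (ha : 0 < a) (f : ℕ → ℝ) :
    a * steinSol a b f 1 = f 0 - pbdExp a b f := by
  have h := steinSol_eq (b := b) ha f 0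
  rwa [deathRate_zero, zero_mul, sub_zero] at h

theorem linSol_eq (ha : 0 < a) (i : ℕ) :
    a * linSol a b (i + 1) - deathRate b i * linSol a b i = -i + pbdMean a b := by
  rw [linSol, steinSol_eq ha, pbdExp_neg, pbdMean]; ring

theorem linSol_one (ha : 0 < a) : linSol a b 1 = pbdMean a b / a := by
  rw [eq_div_iff ha.ne', mul_comm, linSol, steinSol_one ha, pbdExp_neg, pbdMean]; simp

theorem boundedSeq_linSol (ha : 0 < a) (hb : 0 ≤ b) : BoundedSeq (linSol a b) :=
  boundedSeq_steinSol ha hb LinearGrowth.natCast.neg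

theorem shiftGen_linSol (ha : 0 < a) (j : ℕ) :
    shiftGen a b (linSol a b) j = 1 * (1 + 2 * b * j) * linSol a b (j + 1) + -1 := by
  rw [linSol, shiftGen_steinSol ha]; push_cast; ring

theorem shiftGen_fwdDiff_linSol (ha : 0 < a) (j : ℕ) :
    shiftGen a b (fwdDiff 1 (linSol a b)) j =
      2 * (1 + 2 * b * j) * fwdDiff 1 (linSol a b) (j + 1) + 2 * b * linSol a b (j + 2) := by
  rw [linSol, shiftGen_fwdDiff_steinSol ha]; push_cast; ring

theorem shiftGen_fwdDiff2_linSol (ha : 0 < a) (j : ℕ) :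
    shiftGen a b (fwdDiff 1 (fwdDiff 1 (linSol a b))) j =
      3 * (1 + 2 * b * j) * fwdDiff 1 (fwdDiff 1 (linSol a b)) (j + 1) +
        6 * b * fwdDiff 1 (linSol a b) (j + 2) := by
  have h' := shiftGen_fwdDiff_linSol (b := b) ha (j + 1)
  push_cast at h'
  have h := shiftGen_fwdDiff (R := fun j => 2 * b * linSol a b (j + 2))
    (shiftGen_fwdDiff_linSol (b := b) ha j) h'
  rw [h]
  simp only [fwdDiff]; ring

theorem shiftGen_fwdDiff3_linSol (ha : 0 < a) (j : ℕ) :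
    shiftGen a b (fwdDiff 1 (fwdDiff 1 (fwdDiff 1 (linSol a b)))) j =
      4 * (1 + 2 * b * j) * fwdDiff 1 (fwdDiff 1 (fwdDiff 1 (linSol a b))) (j + 1) +
        12 * b * fwdDiff 1 (fwdDiff 1 (linSol a b)) (j + 2) := by
  have h' := shiftGen_fwdDiff2_linSol (b := b) ha (j + 1)
  push_cast at h'
  have h := shiftGen_fwdDiff (R := fun j => 6 * b * fwdDiff 1 (linSol a b) (j + 2))
    (shiftGen_fwdDiff2_linSol (b := b) ha j) h'
  rw [h]
  simp only [fwdDiff]; ring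

theorem shiftGen_neg (ψ : ℕ → ℝ) (j : ℕ) :
    shiftGen a b (fun j => -ψ j) j = -shiftGen a b ψ j := by
  simp only [shiftGen]; ring

theorem shiftGen_add (φ ψ : ℕ → ℝ) (j : ℕ) :
    shiftGen a b (fun j => φ j + ψ j) j = shiftGen a b φ j + shiftGen a b ψ j := by
  simp only [shiftGen]; ring

theorem linSol_nonneg (ha : 0 < a) (hb : 0 ≤ b) (n : ℕ) : 0 ≤ linSol a b (n + 1) := by
  refine nonneg_of_shiftGen_le ha hb (boundedSeq_linSol ha hb)
    (fun j => one_le_killing hb le_rfl j) (fun j => Or.inr ?_) n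
  rw [shiftGen_linSol ha]; linarith

theorem fwdDiff_linSol_nonpos (ha : 0 < a) (hb : 0 ≤ b) (n : ℕ) :
    fwdDiff 1 (linSol a b) (n + 1) ≤ 0 := by
  refine neg_nonneg.1 (nonneg_of_shiftGen_le ha hb (boundedSeq_linSol ha hb).fwdDiff.neg
    (fun j => one_le_killing hb one_le_two j) (fun j => Or.inr ?_) n)
  rw [shiftGen_neg, shiftGen_fwdDiff_linSol ha]
  linarith [mul_nonneg hb (linSol_nonneg ha hb (j + 1))]

theorem fwdDiff2_linSol_nonneg (ha : 0 < a) (hb : 0 ≤ b) (n : ℕ) :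
    0 ≤ fwdDiff 1 (fwdDiff 1 (linSol a b)) (n + 1) := by
  refine nonneg_of_shiftGen_le ha hb (boundedSeq_linSol ha hb).fwdDiff.fwdDiff
    (fun j => one_le_killing hb (by norm_num : (1 : ℝ) ≤ 3) j) (fun j => Or.inr ?_) n
  rw [shiftGen_fwdDiff2_linSol ha]
  linarith [mul_nonneg hb (neg_nonneg.2 (fwdDiff_linSol_nonpos ha hb (j + 1)))]

theorem fwdDiff3_linSol_nonpos (ha : 0 < a) (hb : 0 ≤ b) (n : ℕ) :
    fwdDiff 1 (fwdDiff 1 (fwdDiff 1 (linSol a b))) (n + 1) ≤ 0 := by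
  refine neg_nonneg.1 (nonneg_of_shiftGen_le ha hb
    (boundedSeq_linSol ha hb).fwdDiff.fwdDiff.fwdDiff.neg
    (fun j => one_le_killing hb (by norm_num : (1 : ℝ) ≤ 4) j) (fun j => Or.inr ?_) n)
  rw [shiftGen_neg, shiftGen_fwdDiff3_linSol ha]
  linarith [mul_nonneg hb (fwdDiff2_linSol_nonneg ha hb (j + 1))]

theorem linSol_le (ha : 0 < a) (hb : 0 ≤ b) (n : ℕ) : linSol a b (n + 1) ≤ pbdMean a b / a := by
  rw [← linSol_one (b := b) ha]
  induction n with
  | zero => rfl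
  | succ n ih => exact (sub_nonpos.1 (fwdDiff_linSol_nonpos ha hb n)).trans ih

theorem fwdDiff_linSol_one (ha : 0 < a) :
    fwdDiff 1 (linSol a b) 1 = -((1 - pbdMean a b / a) / a) := by
  have h := fwdDiff_steinSol_one (b := b) ha (fun n => -(n : ℝ))
  rw [pbdExp_neg] at h
  rw [linSol, ← mul_right_inj' (pow_ne_zero 2 ha.ne'), h]
  simp only [pbdMean]
  field_simp
  push_cast
  ring

theorem neg_fwdDiff_linSol_le (ha : 0 < a) (hb : 0 ≤ b) (n : ℕ) :
    -fwdDiff 1 (linSol a b) (n + 1) ≤ (1 - pbdMean a b / a) / a := by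
  rw [neg_le, ← fwdDiff_linSol_one ha]
  induction n with
  | zero => rfl
  | succ n ih => exact ih.trans (sub_nonneg.1 (fwdDiff2_linSol_nonneg ha hb n))

theorem fwdDiff2_linSol_one (ha : 0 < a) :
    fwdDiff 1 (fwdDiff 1 (linSol a b)) 1 =
      2 * (pbdMean a b / a * (1 + b + a * b) - (1 + b)) / a ^ 2 := by
  have h0 := linSol_eq (b := b) ha 0
  have h1 := linSol_eq (b := b) ha 1
  have h2 := linSol_eq (b := b) ha 2
  have d1 : deathRate b 1 = 1 := by simp [deathRate]
  have d2 : deathRate b 2 = 2 + 2 * b := by simp only [deathRate]; push_cast; ring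
  rw [deathRate_zero] at h0
  rw [d1] at h1
  rw [d2] at h2
  simp only [fwdDiff]
  norm_num at h0 h1 h2 ⊢
  rw [← h0]
  field_simp
  linear_combination a * h2 + (2 + 2 * b - 2 * a) * h1 - (2 + 2 * b - a) * h0

theorem fwdDiff2_linSol_le (ha : 0 < a) (hb : 0 ≤ b) (n : ℕ) :
    fwdDiff 1 (fwdDiff 1 (linSol a b)) (n + 1) ≤ b / ((a + 1) * b + 1 + a / 2) := by
  have h1 : fwdDiff 1 (fwdDiff 1 (linSol a b)) (n + 1) ≤
      fwdDiff 1 (fwdDiff 1 (linSol a b)) 1 := by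
    induction n with
    | zero => rfl
    | succ n ih => exact (sub_nonpos.1 (fwdDiff3_linSol_nonpos ha hb n)).trans ih
  refine h1.trans ?_
  rw [fwdDiff2_linSol_one ha, div_le_div_iff₀ (by positivity) (by positivity)]
  have h2 := mean_mul_le ha hb
  set m := pbdMean a b
  have h3 : m / a * (a + 2 * b + 2 + 2 * a * b) ≤ a + 2 * b + 2 := by
    rw [div_mul_eq_mul_div, div_le_iff₀ ha]; linarith
  nlinarith [mul_le_mul_of_nonneg_left h3 (show 0 ≤ 1 + b + a * b by positivity)]

theorem abs_sub_succ_le {f : ℕ → ℝ} (hf : f ∈ lipOne) (n : ℕ) : |f (n + 1) - f n| ≤ 1 := by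
  have h := hf (n + 1) n
  push_cast at h
  rwa [add_sub_cancel_left, abs_one] at h

/-- Among all Lipschitz test functions the linear one has the largest Stein solution. -/
theorem abs_steinSol_le (ha : 0 < a) (hb : 0 ≤ b) {f : ℕ → ℝ} (hf : f ∈ lipOne) (n : ℕ) :
    |steinSol a b f (n + 1)| ≤ linSol a b (n + 1) := by
  have key : ∀ f ∈ lipOne, steinSol a b f (n + 1) ≤ linSol a b (n + 1) := by
    intro f hf
    have hfb := (boundedSeq_steinSol ha hb (.of_lipOne hf)).neg
    have := nonneg_of_shiftGen_le ha hb ((boundedSeq_linSol ha hb).add hfb)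
      (fun j => one_le_killing hb le_rfl j) (fun j => Or.inr ?_) n
    · linarith
    · rw [shiftGen_add, shiftGen_neg, shiftGen_linSol ha, shiftGen_steinSol ha]
      linarith [neg_le_of_abs_le (abs_sub_succ_le hf j)]
  refine abs_le.2 ⟨?_, key f hf⟩
  have h := key _ (neg_mem_lipOne hf)
  rw [steinSol_neg] at h
  linarith

end LinSol

/-! ### The left and right fundamental solutions -/

/-- The left fundamental solution `A(i) = P(X < i) / (a π_{i-1})`, `i ≥ 1`, which solves
`a A(i+1) - β_i A(i) = 1` for all `i`. To the left of the support of a test function every Stein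
solution is a multiple of it. -/
noncomputable def leftSol (a b : ℝ) : ℕ → ℝ := recSol a b (fun _ => 1)

/-- The right fundamental solution: the Stein solution for the indicator of `{0}`. To the right of
the support of a test function every Stein solution is a multiple of it. -/
noncomputable def rightSol (a b : ℝ) : ℕ → ℝ := steinSol a b (fun n => if n = 0 then 1 else 0)

namespace LinearGrowth

theorem comp_min {h : ℕ → ℝ} (hh : LinearGrowth h) (i : ℕ) :
    LinearGrowth (fun x => h (min x i)) := by
  obtain ⟨C, hC⟩ := hh
  have hC0 : 0 ≤ C := by simpa using (abs_nonneg _).trans (hC 0)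
  refine ⟨C, fun n => (hC _).trans (mul_le_mul_of_nonneg_left ?_ hC0)⟩
  have : ((min n i : ℕ) : ℝ) ≤ n := by exact_mod_cast min_le_left n i
  linarith

theorem comp_max {h : ℕ → ℝ} (hh : LinearGrowth h) (i : ℕ) :
    LinearGrowth (fun x => h (max x i)) := by
  obtain ⟨C, hC⟩ := hh
  have hC0 : 0 ≤ C := by simpa using (abs_nonneg _).trans (hC 0)
  refine ⟨C * (i + 1), fun n => (hC _).trans ?_⟩
  rw [mul_assoc]
  refine mul_le_mul_of_nonneg_left ?_ hC0
  have : ((max n i : ℕ) : ℝ) ≤ n + i := by exact_mod_cast max_le (by omega) (by omega)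
  have h2 : (0 : ℝ) ≤ n * i := by positivity
  linarith

theorem ite (p : ℕ → Prop) [DecidablePred p] (c d : ℝ) :
    LinearGrowth (fun n => if p n then c else d) :=
  ((const |c|).add (const |d|)).of_abs_le fun n => by
    rw [abs_of_nonneg (by positivity : 0 ≤ |c| + |d|)]
    split_ifs
    · linarith [abs_nonneg d]
    · linarith [abs_nonneg c]

end LinearGrowth

section Fundamental

variable {a b : ℝ}

theorem leftSol_nonneg (ha : 0 < a) (hb : 0 ≤ b) (j : ℕ) : 0 ≤ leftSol a b j := by
  induction j with
  | zero => exact div_nonneg zero_le_one ha.le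
  | succ j ih =>
    exact div_nonneg (add_nonneg zero_le_one (mul_nonneg (deathRate_nonneg hb j) ih)) ha.le

theorem leftSol_eq (ha : 0 < a) (j : ℕ) :
    a * leftSol a b (j + 1) - deathRate b j * leftSol a b j = 1 := recSol_eq ha _ j

theorem fwdDiff_leftSol_eq (ha : 0 < a) (j : ℕ) :
    a * fwdDiff 1 (leftSol a b) (j + 1) =
      deathRate b j * fwdDiff 1 (leftSol a b) j + (1 + 2 * b * j) * leftSol a b (j + 1) := by
  have h := leftSol_eq (b := b) ha j
  have h' := leftSol_eq (b := b) ha (j + 1)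
  simp only [fwdDiff, deathRate_succ] at *
  linear_combination h' - h

theorem fwdDiff_leftSol_nonneg (ha : 0 < a) (hb : 0 ≤ b) (j : ℕ) :
    0 ≤ fwdDiff 1 (leftSol a b) j := by
  induction j with
  | zero => exact (sub_eq_zero.2 (recSol_zero _).symm).ge
  | succ j ih =>
    refine nonneg_of_mul_nonneg_right ?_ ha
    rw [fwdDiff_leftSol_eq ha]
    have h1 := mul_nonneg (deathRate_nonneg hb j) ih
    have h2 := leftSol_nonneg ha hb (j + 1)
    positivity

theorem fwdDiff2_leftSol_nonneg (ha : 0 < a) (hb : 0 ≤ b) (j : ℕ) :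
    0 ≤ fwdDiff 1 (fwdDiff 1 (leftSol a b)) j := by
  induction j with
  | zero =>
    have h0 : fwdDiff 1 (leftSol a b) 0 = 0 := sub_eq_zero.2 (recSol_zero _).symm
    have h1 := fwdDiff_leftSol_nonneg ha hb 1
    change 0 ≤ fwdDiff 1 (leftSol a b) 1 - fwdDiff 1 (leftSol a b) 0
    linarith
  | succ j ih =>
    refine nonneg_of_mul_nonneg_right ?_ ha
    have h := fwdDiff_leftSol_eq (b := b) ha j
    have h' := fwdDiff_leftSol_eq (b := b) ha (j + 1)
    have e : a * fwdDiff 1 (fwdDiff 1 (leftSol a b)) (j + 1) =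
        deathRate b j * fwdDiff 1 (fwdDiff 1 (leftSol a b)) j +
          2 * (1 + 2 * b * j) * fwdDiff 1 (leftSol a b) (j + 1) +
          2 * b * leftSol a b (j + 2) := by
      simp only [fwdDiff, deathRate_succ] at *
      push_cast at h'
      linear_combination h' - h
    rw [e]
    have h1 := mul_nonneg (deathRate_nonneg hb j) ih
    have h2 := fwdDiff_leftSol_nonneg ha hb (j + 1)
    have h3 := leftSol_nonneg ha hb (j + 2)
    positivity

theorem linearGrowth_indicator_zero : LinearGrowth (fun n => if n = 0 then (1 : ℝ) else 0) :=
  LinearGrowth.ite _ 1 0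

theorem boundedSeq_rightSol (ha : 0 < a) (hb : 0 ≤ b) : BoundedSeq (rightSol a b) :=
  boundedSeq_steinSol ha hb linearGrowth_indicator_zero

theorem rightSol_eq (ha : 0 < a) (j : ℕ) :
    a * rightSol a b (j + 2) - deathRate b (j + 1) * rightSol a b (j + 1) = -pbd a b 0 := by
  rw [rightSol, steinSol_eq ha, pbdExp_indicator_zero]; simp

theorem rightSol_one (ha : 0 < a) : a * rightSol a b 1 = 1 - pbd a b 0 := by
  rw [rightSol, steinSol_one ha, pbdExp_indicator_zero]; simp

theorem pbd_zero_le_one (ha : 0 < a) (hb : 0 ≤ b) : pbd a b 0 ≤ 1 :=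
  le_hasSum (hasSum_pbd ha hb) 0 fun n _ => (pbd_pos ha hb n).le

theorem shiftGen_rightSol (ha : 0 < a) (j : ℕ) :
    shiftGen a b (rightSol a b) (j + 1) =
      1 * (1 + 2 * b * (j + 1)) * rightSol a b (j + 2) := by
  rw [rightSol, shiftGen_steinSol ha]; simp

theorem shiftGen_fwdDiff_rightSol (ha : 0 < a) (j : ℕ) :
    shiftGen a b (fwdDiff 1 (rightSol a b)) (j + 1) =
      2 * (1 + 2 * b * (j + 1)) * fwdDiff 1 (rightSol a b) (j + 2) +
        2 * b * rightSol a b (j + 3) := by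
  rw [rightSol, shiftGen_fwdDiff_steinSol ha]; simp

theorem shiftGen_fwdDiff2_rightSol (ha : 0 < a) (j : ℕ) :
    shiftGen a b (fwdDiff 1 (fwdDiff 1 (rightSol a b))) (j + 1) =
      3 * (1 + 2 * b * (j + 1)) * fwdDiff 1 (fwdDiff 1 (rightSol a b)) (j + 2) +
        6 * b * fwdDiff 1 (rightSol a b) (j + 3) := by
  have h := shiftGen_fwdDiff_rightSol (b := b) ha j
  have h' := shiftGen_fwdDiff_rightSol (b := b) ha (j + 1)
  push_cast at h'
  have h2 := shiftGen_fwdDiff (j := j + 1) (c := 2) (R := fun j => 2 * b * rightSol a b (j + 2))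
    (by push_cast; exact h) (by push_cast; exact h')
  rw [h2]
  push_cast
  simp only [fwdDiff]; ring

theorem rightSol_nonneg (ha : 0 < a) (hb : 0 ≤ b) (n : ℕ) : 0 ≤ rightSol a b (n + 1) := by
  refine nonneg_of_shiftGen_le ha hb (boundedSeq_rightSol ha hb)
    (fun j => one_le_killing hb le_rfl j) (fun j => ?_) n
  cases j with
  | zero =>
    refine Or.inl (nonneg_of_mul_nonneg_right ?_ ha)
    rw [zero_add, rightSol_one ha]; linarith [pbd_zero_le_one ha hb]
  | succ j => right; rw [shiftGen_rightSol ha]; push_cast; exact le_rfl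

theorem fwdDiff_rightSol_nonpos (ha : 0 < a) (hb : 0 ≤ b) (n : ℕ) :
    fwdDiff 1 (rightSol a b) (n + 1) ≤ 0 := by
  refine neg_nonneg.1 (nonneg_of_shiftGen_le ha hb (boundedSeq_rightSol ha hb).fwdDiff.neg
    (fun j => one_le_killing hb one_le_two j) (fun j => ?_) n)
  cases j with
  | zero =>
    left
    have h := fwdDiff_steinSol_one (b := b) ha (fun n => if n = 0 then 1 else 0)
    rw [pbdExp_indicator_zero] at h
    simp only [one_ne_zero, if_false, if_true] at h
    have h1 := one_sub_pbd_zero_le ha hb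
    rw [neg_nonneg]
    refine nonpos_of_mul_nonpos_right (a := a ^ 2) ?_ (by positivity)
    exact h.le.trans (by linarith)
  | succ j =>
    right
    rw [shiftGen_neg, shiftGen_fwdDiff_rightSol ha]
    push_cast
    linarith [mul_nonneg hb (rightSol_nonneg ha hb (j + 2))]

theorem fwdDiff2_rightSol_nonneg (ha : 0 < a) (hb : 0 ≤ b) (n : ℕ) :
    0 ≤ fwdDiff 1 (fwdDiff 1 (rightSol a b)) (n + 1) := by
  refine nonneg_of_shiftGen_le ha hb (boundedSeq_rightSol ha hb).fwdDiff.fwdDiff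
    (fun j => one_le_killing hb (by norm_num : (1 : ℝ) ≤ 3) j) (fun j => ?_) n
  cases j with
  | zero =>
    left
    have h1 := rightSol_one (b := b) ha
    have h2 := rightSol_eq (b := b) ha 0
    have h3 := rightSol_eq (b := b) ha 1
    have d1 : deathRate b (0 + 1) = 1 := by simp [deathRate]
    have d2 : deathRate b (1 + 1) = 2 + 2 * b := by simp only [deathRate]; push_cast; ring
    rw [d1] at h2
    rw [d2] at h3
    have e : a ^ 3 * fwdDiff 1 (fwdDiff 1 (rightSol a b)) (0 + 1) =
        2 + 2 * b + a ^ 2 - 2 * a - pbd a b 0 * (2 + 2 * b + 2 * a * b) := by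
      simp only [fwdDiff]
      norm_num at h1 h2 h3 ⊢
      linear_combination a ^ 2 * h3 + (a * (2 + 2 * b) - 2 * a ^ 2) * h2 +
        (a ^ 2 - 2 * a + 2 + 2 * b) * h1
    refine nonneg_of_mul_nonneg_right (a := a ^ 3) ?_ (by positivity)
    rw [e]
    have h4 := pbd_zero_mul_le ha hb
    set D := a ^ 2 + 2 * a + 2 + 2 * b * (a + 1) with hD
    have hDpos : 0 < D := by positivity
    have h5 := mul_le_mul_of_nonneg_right h4 (show 0 ≤ 2 + 2 * b + 2 * a * b by positivity)
    have h6 : (2 + 2 * b + a ^ 2 - 2 * a) * D - 2 * (1 + b) * (2 + 2 * b + 2 * a * b) =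
        a ^ 3 * (2 * b + a) := by rw [hD]; ring
    have h7 : 0 ≤ a ^ 3 * (2 * b + a) := by positivity
    refine nonneg_of_mul_nonneg_left (b := D) ?_ hDpos
    linarith
  | succ j =>
    right
    rw [shiftGen_fwdDiff2_rightSol ha]
    push_cast
    linarith [mul_nonneg hb (neg_nonneg.2 (fwdDiff_rightSol_nonpos ha hb (j + 2)))]

/-- A bounded solution of the homogeneous equation on a right half-line vanishes, since
`a π_j w(j+1)` is constant and tends to zero. -/
theorem eq_zero_of_homogeneous (ha : 0 < a) (hb : 0 ≤ b) {w : ℕ → ℝ} (hw : BoundedSeq w) {k : ℕ}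
    (h : ∀ j ≥ k + 1, a * w (j + 1) - deathRate b j * w j = 0) : w (k + 1) = 0 := by
  obtain ⟨K, hK⟩ := hw
  have hconst (n : ℕ) : pbd a b (k + n) * w (k + n + 1) = pbd a b k * w (k + 1) := by
    induction n with
    | zero => rfl
    | succ n ih =>
      rw [← ih, ← mul_right_inj' ha.ne']
      have h1 := h (k + n + 1) (by omega)
      have h2 := pbd_balance ha hb (k + n)
      rw [← add_assoc]
      linear_combination pbd a b (k + n + 1) * h1 + w (k + n + 1) * h2
  have hlim : Filter.Tendsto (fun n => pbd a b (k + n) * w (k + n + 1)) Filter.atTop (nhds 0) := by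
    have h0 : Filter.Tendsto (fun n => pbd a b (k + n) * K) Filter.atTop (nhds 0) := by
      have := ((hasSum_pbd ha hb).summable.tendsto_atTop_zero.comp
        (Filter.tendsto_add_atTop_nat k)).mul_const K
      simpa only [zero_mul, Function.comp_def, add_comm] using this
    refine squeeze_zero_norm (fun n => ?_) h0
    rw [Real.norm_eq_abs, abs_mul, abs_of_pos (pbd_pos ha hb _)]
    exact mul_le_mul_of_nonneg_left (hK _) (pbd_pos ha hb _).le
  simp only [hconst] at hlim
  have h3 := tendsto_nhds_unique tendsto_const_nhds hlim
  exact (mul_eq_zero.1 h3).resolve_left (pbd_pos ha hb k).ne'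

theorem steinSol_eq_right (ha : 0 < a) (hb : 0 ≤ b) {h : ℕ → ℝ} (hh : LinearGrowth h) {i : ℕ}
    (hi : 1 ≤ i) (hz : ∀ x ≥ i, h x = 0) (j : ℕ) (hj : i ≤ j) :
    steinSol a b h j = pbdExp a b h / pbd a b 0 * rightSol a b j := by
  obtain ⟨k, rfl⟩ := Nat.exists_eq_add_of_le' (hi.trans hj)
  refine sub_eq_zero.1 (eq_zero_of_homogeneous ha hb ((boundedSeq_steinSol ha hb hh).sub
    ((boundedSeq_rightSol ha hb).const_mul (pbdExp a b h / pbd a b 0))) fun l hl => ?_)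
  have h1 := steinSol_eq (b := b) ha h l
  rw [hz l (hj.trans hl)] at h1
  obtain ⟨l, rfl⟩ := Nat.exists_eq_add_of_le' (le_trans (Nat.le_add_left 1 k) hl)
  have h2 := rightSol_eq (b := b) ha l
  have h3 : pbdExp a b h / pbd a b 0 * pbd a b 0 = pbdExp a b h :=
    div_mul_cancel₀ _ (pbd_pos ha hb 0).ne'
  linear_combination h1 - pbdExp a b h / pbd a b 0 * h2 + h3

theorem steinSol_eq_left (ha : 0 < a) {h : ℕ → ℝ} {n : ℕ} (hz : ∀ x ≤ n, h x = 0)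
    (j : ℕ) (hj : j ≤ n + 1) : steinSol a b h j = -pbdExp a b h * leftSol a b j := by
  have h1 : ∀ i ≤ n, steinSol a b h (i + 1) = -pbdExp a b h * leftSol a b (i + 1) := by
    intro i hi
    rw [leftSol, ← recSol_const_mul]
    refine eq_recSol ha (fun l hl => ?_) i hi
    rw [steinSol_eq ha, hz l hl]; ring
  cases j with
  | zero =>
    rw [(isSteinSolution_steinSol ha h).2, leftSol, recSol_zero]
    exact h1 0 (Nat.zero_le n)
  | succ j => exact h1 j (by omega)

theorem fwdDiff_congr {f g : ℕ → ℝ} {j : ℕ} (h0 : f j = g j) (h1 : f (j + 1) = g (j + 1)) :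
    fwdDiff 1 f j = fwdDiff 1 g j := by
  simp only [fwdDiff, h0, h1]

theorem fwdDiff2_congr {f g : ℕ → ℝ} {j : ℕ} (h0 : f j = g j) (h1 : f (j + 1) = g (j + 1))
    (h2 : f (j + 2) = g (j + 2)) :
    fwdDiff 1 (fwdDiff 1 f) j = fwdDiff 1 (fwdDiff 1 g) j :=
  fwdDiff_congr (fwdDiff_congr h0 h1) (fwdDiff_congr h1 h2)

theorem fwdDiff_mul_left (c : ℝ) (f : ℕ → ℝ) (j : ℕ) :
    fwdDiff 1 (fun n => c * f n) j = c * fwdDiff 1 f j := by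
  simp only [fwdDiff]; ring

theorem fwdDiff2_mul_left (c : ℝ) (f : ℕ → ℝ) (j : ℕ) :
    fwdDiff 1 (fwdDiff 1 (fun n => c * f n)) j = c * fwdDiff 1 (fwdDiff 1 f) j := by
  simp only [fwdDiff]; ring

theorem pbdExp_nonpos (ha : 0 < a) (hb : 0 ≤ b) {f : ℕ → ℝ} (h : ∀ n, f n ≤ 0) :
    pbdExp a b f ≤ 0 :=
  tsum_nonpos fun n => mul_nonpos_of_nonpos_of_nonneg (h n) (pbd_pos ha hb n).le

/-! ### Comparison of differences of Stein solutions -/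

theorem fwdDiff_steinSol_right (ha : 0 < a) (hb : 0 ≤ b) {h : ℕ → ℝ} (hh : LinearGrowth h) {i : ℕ}
    (hi : 1 ≤ i) (hz : ∀ x ≥ i, h x = 0) :
    fwdDiff 1 (steinSol a b h) i = pbdExp a b h / pbd a b 0 * fwdDiff 1 (rightSol a b) i := by
  rw [← fwdDiff_mul_left]
  exact fwdDiff_congr (steinSol_eq_right ha hb hh hi hz _ le_rfl)
    (steinSol_eq_right ha hb hh hi hz _ (by omega))

theorem fwdDiff_steinSol_left (ha : 0 < a) {h : ℕ → ℝ} {i : ℕ} (hz : ∀ x ≤ i, h x = 0) :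
    fwdDiff 1 (steinSol a b h) i = -pbdExp a b h * fwdDiff 1 (leftSol a b) i := by
  rw [← fwdDiff_mul_left]
  exact fwdDiff_congr (steinSol_eq_left ha hz _ (by omega)) (steinSol_eq_left ha hz _ le_rfl)

/-- If the test function is largest at `i`, then its Stein solution increases from `i` to `i + 1`:
the parts of the test function to the left and to the right of `i` contribute nonnegative multiples
of the increments of the right and left fundamental solutions. -/
theorem fwdDiff_steinSol_nonneg (ha : 0 < a) (hb : 0 ≤ b) {h : ℕ → ℝ} (hh : LinearGrowth h) {i : ℕ}
    (hi : 1 ≤ i) (hmax : ∀ x, h x ≤ h i) : 0 ≤ fwdDiff 1 (steinSol a b h) i := by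
  have g1 := (hh.comp_min i).sub (.const (h i))
  have g2 := (hh.comp_max i).sub (.const (h i))
  have hdec (j : ℕ) : steinSol a b h j = steinSol a b (fun x => h (min x i) - h i) j +
      steinSol a b (fun x => h (max x i) - h i) j := by
    rw [← steinSol_add ha hb g1 g2, ← steinSol_add_const ha hb (g1.add g2) (h i)]
    congr 1
    funext x
    rcases le_total x i with hx | hx
    · rw [min_eq_left hx, max_eq_right hx]; ring
    · rw [min_eq_right hx, max_eq_left hx]; ring
  have e1 := fwdDiff_steinSol_right ha hb g1 hi (fun x hx => by rw [min_eq_right hx, sub_self])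
  have e2 := fwdDiff_steinSol_left (b := b) (h := fun x => h (max x i) - h i) ha
    (fun x hx => by rw [max_eq_right hx, sub_self])
  have p1 : pbdExp a b (fun x => h (min x i) - h i) ≤ 0 :=
    pbdExp_nonpos ha hb fun n => sub_nonpos.2 (hmax _)
  have p2 : pbdExp a b (fun x => h (max x i) - h i) ≤ 0 :=
    pbdExp_nonpos ha hb fun n => sub_nonpos.2 (hmax _)
  have e : fwdDiff 1 (steinSol a b h) i =
      fwdDiff 1 (steinSol a b (fun x => h (min x i) - h i)) i +
        fwdDiff 1 (steinSol a b (fun x => h (max x i) - h i)) i := by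
    simp only [fwdDiff, hdec]; ring
  obtain ⟨k, rfl⟩ := Nat.exists_eq_add_of_le' hi
  rw [e, e1, e2]
  exact add_nonneg (mul_nonneg_of_nonpos_of_nonpos
    (div_nonpos_of_nonpos_of_nonneg p1 (pbd_pos ha hb 0).le) (fwdDiff_rightSol_nonpos ha hb k))
    (mul_nonneg (neg_nonneg.2 p2) (fwdDiff_leftSol_nonneg ha hb _))

/-- The indicator of `(i, ∞)`. -/
noncomputable def stepFun (i n : ℕ) : ℝ := if n ≤ i then 0 else 1

theorem linearGrowth_stepFun (i : ℕ) : LinearGrowth (stepFun i) := LinearGrowth.ite _ 0 1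

theorem stepFun_nonneg (i n : ℕ) : 0 ≤ stepFun i n := by
  unfold stepFun; split_ifs <;> norm_num

theorem stepFun_le_one (i n : ℕ) : stepFun i n ≤ 1 := by
  unfold stepFun; split_ifs <;> norm_num

theorem stepFun_of_le {i n : ℕ} (h : n ≤ i) : stepFun i n = 0 := if_pos h

theorem stepFun_of_lt {i n : ℕ} (h : i < n) : stepFun i n = 1 := if_neg (not_le.2 h)

theorem fwdDiff2_steinSol_stepFun_nonneg (ha : 0 < a) (hb : 0 ≤ b) (i : ℕ) :
    0 ≤ fwdDiff 1 (fwdDiff 1 (steinSol a b (stepFun i))) i := by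
  have h1 : fwdDiff 1 (steinSol a b (stepFun i)) i ≤ 0 := by
    rw [fwdDiff_steinSol_left ha fun x hx => stepFun_of_le hx]
    exact mul_nonpos_of_nonpos_of_nonneg
      (neg_nonpos.2 (pbdExp_nonneg ha hb (stepFun_nonneg i))) (fwdDiff_leftSol_nonneg ha hb i)
  have h2 : 0 ≤ fwdDiff 1 (steinSol a b (stepFun i)) (i + 1) := by
    have hl := (linearGrowth_stepFun i).add (.const (-1))
    have e : fwdDiff 1 (steinSol a b (stepFun i)) (i + 1) =
        fwdDiff 1 (steinSol a b (fun n => stepFun i n + -1)) (i + 1) :=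
      fwdDiff_congr (steinSol_add_const ha hb (linearGrowth_stepFun i) _ _).symm
        (steinSol_add_const ha hb (linearGrowth_stepFun i) _ _).symm
    rw [e, fwdDiff_steinSol_right ha hb hl (by omega) fun x hx => by
      rw [stepFun_of_lt (by omega)]; norm_num]
    refine mul_nonneg_of_nonpos_of_nonpos
      (div_nonpos_of_nonpos_of_nonneg (pbdExp_nonpos ha hb fun n => ?_) (pbd_pos ha hb 0).le)
      (fwdDiff_rightSol_nonpos ha hb i)
    linarith [stepFun_le_one i n]
  exact sub_nonneg.2 (h1.trans h2)

theorem fwdDiff2_steinSol_stepFun_le (ha : 0 < a) (hb : 0 ≤ b) (i : ℕ) :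
    fwdDiff 1 (fwdDiff 1 (steinSol a b (stepFun i))) i ≤ 1 / a := by
  rw [le_div_iff₀ ha]
  have s1 := steinSol_eq (b := b) ha (stepFun i) (i + 1)
  rw [stepFun_of_lt (Nat.lt_succ_self i)] at s1
  have l0 := steinSol_eq_left (b := b) (h := stepFun i) ha (fun x hx => stepFun_of_le hx) i
    (by omega)
  have l1 := steinSol_eq_left (b := b) (h := stepFun i) ha (fun x hx => stepFun_of_le hx) (i + 1)
    le_rfl
  have A1 := leftSol_eq (b := b) ha (i + 1)
  set c := pbdExp a b (stepFun i)
  have hc : 0 ≤ c := pbdExp_nonneg ha hb (stepFun_nonneg i)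
  have e : fwdDiff 1 (fwdDiff 1 (steinSol a b (stepFun i))) i * a =
      1 - c * (a * fwdDiff 1 (fwdDiff 1 (leftSol a b)) i) := by
    simp only [fwdDiff] at *
    rw [l1] at s1
    rw [l1, l0]
    linear_combination s1 + c * A1
  rw [e]
  have := mul_nonneg hc (mul_nonneg ha.le (fwdDiff2_leftSol_nonneg ha hb i))
  linarith

/-- A test function that lies above `h i` up to `i`, jumps up from `i` to `i + 1`, and lies below
`h (i + 1)` afterwards has a Stein solution with a nonnegative second difference at `i`: the three
pieces are governed by the convexity of the fundamental solutions and by a step function. -/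
theorem fwdDiff2_steinSol_nonneg (ha : 0 < a) (hb : 0 ≤ b) {h : ℕ → ℝ} (hh : LinearGrowth h)
    {i : ℕ} (hi : 1 ≤ i) (hl : ∀ x ≤ i, h i ≤ h x) (hr : ∀ x ≥ i + 1, h x ≤ h (i + 1))
    (hs : h i ≤ h (i + 1)) : 0 ≤ fwdDiff 1 (fwdDiff 1 (steinSol a b h)) i := by
  have g1 := (hh.comp_min i).sub (.const (h i))
  have g2 := (hh.comp_max (i + 1)).sub (.const (h (i + 1)))
  have g3 := (linearGrowth_stepFun i).const_mul (h (i + 1) - h i)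
  have hdec (j : ℕ) : steinSol a b h j = steinSol a b (fun x => h (min x i) - h i) j +
      steinSol a b (fun x => h (max x (i + 1)) - h (i + 1)) j +
      (h (i + 1) - h i) * steinSol a b (stepFun i) j := by
    rw [← steinSol_const_mul, ← steinSol_add ha hb g1 g2, ← steinSol_add ha hb (g1.add g2) g3,
      ← steinSol_add_const ha hb ((g1.add g2).add g3) (h i)]
    congr 1
    funext x
    rcases Nat.lt_or_ge i x with hx | hx
    · rw [min_eq_right hx.le, max_eq_left hx, stepFun_of_lt hx]; ring
    · rw [min_eq_left hx, max_eq_right (by omega), stepFun_of_le hx]; ring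
  have e : fwdDiff 1 (fwdDiff 1 (steinSol a b h)) i =
      fwdDiff 1 (fwdDiff 1 (steinSol a b (fun x => h (min x i) - h i))) i +
      fwdDiff 1 (fwdDiff 1 (steinSol a b (fun x => h (max x (i + 1)) - h (i + 1)))) i +
      (h (i + 1) - h i) * fwdDiff 1 (fwdDiff 1 (steinSol a b (stepFun i))) i := by
    simp only [fwdDiff, hdec]; ring
  have z1 : ∀ x ≥ i, h (min x i) - h i = 0 := fun x hx => by rw [min_eq_right hx, sub_self]
  have z2 : ∀ x ≤ i + 1, h (max x (i + 1)) - h (i + 1) = 0 := fun x hx => by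
    rw [max_eq_right hx, sub_self]
  have e1 : fwdDiff 1 (fwdDiff 1 (steinSol a b (fun x => h (min x i) - h i))) i =
      pbdExp a b (fun x => h (min x i) - h i) / pbd a b 0 *
        fwdDiff 1 (fwdDiff 1 (rightSol a b)) i := by
    rw [← fwdDiff2_mul_left]
    exact fwdDiff2_congr (steinSol_eq_right ha hb g1 hi z1 _ le_rfl)
      (steinSol_eq_right ha hb g1 hi z1 _ (by omega))
      (steinSol_eq_right ha hb g1 hi z1 _ (by omega))
  have e2 : fwdDiff 1 (fwdDiff 1 (steinSol a b (fun x => h (max x (i + 1)) - h (i + 1)))) i =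
      -pbdExp a b (fun x => h (max x (i + 1)) - h (i + 1)) *
        fwdDiff 1 (fwdDiff 1 (leftSol a b)) i := by
    rw [← fwdDiff2_mul_left]
    exact fwdDiff2_congr (steinSol_eq_left ha z2 _ (by omega))
      (steinSol_eq_left ha z2 _ (by omega)) (steinSol_eq_left ha z2 _ le_rfl)
  have p1 : 0 ≤ pbdExp a b (fun x => h (min x i) - h i) :=
    pbdExp_nonneg ha hb fun n => sub_nonneg.2 (hl _ (min_le_right n i))
  have p2 : pbdExp a b (fun x => h (max x (i + 1)) - h (i + 1)) ≤ 0 :=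
    pbdExp_nonpos ha hb fun n => sub_nonpos.2 (hr _ (le_max_right n (i + 1)))
  have p3 := mul_nonneg (sub_nonneg.2 hs) (fwdDiff2_steinSol_stepFun_nonneg ha hb i)
  obtain ⟨k, rfl⟩ := Nat.exists_eq_add_of_le' hi
  rw [e, e1, e2]
  exact add_nonneg (add_nonneg (mul_nonneg (div_nonneg p1 (pbd_pos ha hb 0).le)
    (fwdDiff2_rightSol_nonneg ha hb k)) (mul_nonneg (neg_nonneg.2 p2)
    (fwdDiff2_leftSol_nonneg ha hb _))) p3

end Fundamental

/-! ### Uniform bounds for the Stein solutions and their differences -/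

section Bounds

variable {a b : ℝ}

theorem mean_div_le (ha : 0 < a) (hb : 0 ≤ b) :
    pbdMean a b / a ≤ 1 / (1 + 2 * a * b / (a + 2 * b + 2)) := by
  have h := mean_mul_le ha hb
  have hN : 0 < a + 2 * b + 2 := by positivity
  have e : 1 / (1 + 2 * a * b / (a + 2 * b + 2)) =
      (a + 2 * b + 2) / (a + 2 * b + 2 + 2 * a * b) := by field_simp
  rw [e, div_le_div_iff₀ ha (by positivity)]
  linarith

theorem mean_div_le_sqrt (ha : 0 < a) (hb : 0 < b) :
    pbdMean a b / a ≤ (√(a * b + (b - 1) ^ 2 / 4) + (b - 1) / 2) / (a * b) := by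
  have h := mean_sq_le ha hb.le
  set m := pbdMean a b
  have h2 : (b * m - (b - 1) / 2) ^ 2 ≤ a * b + (b - 1) ^ 2 / 4 := by
    have := mul_le_mul_of_nonneg_left h hb.le
    nlinarith
  have h3 := (le_abs_self _).trans (Real.abs_le_sqrt h2)
  rw [div_le_div_iff₀ ha (by positivity)]
  have := mul_le_mul_of_nonneg_left h3 ha.le
  nlinarith

theorem abs_steinSol_le_mean (ha : 0 < a) (hb : 0 ≤ b) {f : ℕ → ℝ} (hf : f ∈ lipOne) (i : ℕ) :
    |steinSol a b f i| ≤ pbdMean a b / a := by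
  cases i with
  | zero =>
    rw [(isSteinSolution_steinSol ha f).2]
    exact (abs_steinSol_le ha hb hf 0).trans (linSol_le ha hb 0)
  | succ i => exact (abs_steinSol_le ha hb hf i).trans (linSol_le ha hb i)

/-- The bound for the increments of the linear solution; the mean is bounded below in terms of
`π_0`, and `π_0` above by the first three weights. -/
theorem neg_fwdDiff_linSol_le_div (ha : 0 < a) (hb : 0 ≤ b) (n : ℕ) :
    -fwdDiff 1 (linSol a b) (n + 1) ≤
      (a + 2 * b) / (a ^ 2 + 2 * a + 2 + 2 * b * (a + 1)) := by
  refine (neg_fwdDiff_linSol_le ha hb n).trans ?_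
  have h1 := mean_ge ha hb
  have h2 := pbd_zero_mul_le ha hb
  set m := pbdMean a b
  set D := a ^ 2 + 2 * a + 2 + 2 * b * (a + 1) with hD
  have hDpos : 0 < D := by positivity
  have e : (1 - m / a) / a = (a - m) / a ^ 2 := by field_simp
  rw [e, div_le_div_iff₀ (by positivity) hDpos]
  have h3 := mul_le_mul_of_nonneg_right h1 hDpos.le
  have h4 := mul_le_mul_of_nonneg_left h2 (show 0 ≤ 2 + a by linarith)
  have h5 : a * D - 2 * D + (2 + a) * (2 * (1 + b)) = (a + 2 * b) * a ^ 2 := by rw [hD]; ring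
  nlinarith

theorem neg_fwdDiff_linSol_le_one_div (ha : 0 < a) (hb : 0 ≤ b) (n : ℕ) :
    -fwdDiff 1 (linSol a b) (n + 1) ≤ 1 / a := by
  refine (neg_fwdDiff_linSol_le ha hb n).trans (div_le_div_of_nonneg_right ?_ ha.le)
  linarith [div_nonneg (mean_nonneg ha hb) ha.le]

/-- The tent function with peak at `i`, the extremal test function for the first difference of the
Stein solution at `i`. -/
def tent (i n : ℕ) : ℝ := -|(n : ℝ) - i|

theorem tent_mem_lipOne (i : ℕ) : tent i ∈ lipOne := by
  intro x y
  have h := abs_abs_sub_abs_le_abs_sub ((x : ℝ) - i) ((y : ℝ) - i)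
  rw [sub_sub_sub_cancel_right] at h
  rw [tent, tent, show -|(x : ℝ) - i| - -|(y : ℝ) - i| = -(|(x : ℝ) - i| - |(y : ℝ) - i|) by ring,
    abs_neg]
  exact h

theorem tent_second_difference (i j : ℕ) :
    tent i (j + 2) - 2 * tent i (j + 1) + tent i j = -(if j + 1 = i then 2 else 0) := by
  simp only [tent]
  push_cast
  rcases lt_trichotomy (j + 1) i with h | h | h
  · have h' : (j : ℝ) + 2 ≤ i := by exact_mod_cast h
    rw [if_neg h.ne, abs_of_nonpos (by linarith), abs_of_nonpos (by linarith),
      abs_of_nonpos (by linarith)]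
    ring
  · have h' : (j : ℝ) + 1 = i := by exact_mod_cast h
    rw [if_pos h, ← h', show (j : ℝ) + 2 - (j + 1) = 1 by ring,
      show (j : ℝ) - (j + 1) = -1 by ring, sub_self, abs_neg, abs_one, abs_zero]
    ring
  · have h' : (i : ℝ) ≤ j := by exact_mod_cast Nat.lt_succ_iff.1 h
    rw [if_neg h.ne', abs_of_nonneg (by linarith), abs_of_nonneg (by linarith),
      abs_of_nonneg (by linarith)]
    ring

/-- The first difference of a Stein solution at `i` is at most that for the tent function with peak
at `i`, which the maximum principle bounds by the decrement of the linear solution and any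
supersolution `χ` with a source of strength two at `i`. -/
theorem abs_fwdDiff_steinSol_le (ha : 0 < a) (hb : 0 ≤ b) {i : ℕ} {χ : ℕ → ℝ} (hχ : BoundedSeq χ)
    (h : ∀ j, shiftGen a b χ j ≤
      (2 * (1 + 2 * b * j) + 2 * b) * χ (j + 1) - (if j + 1 = i + 1 then 2 else 0))
    {f : ℕ → ℝ} (hf : f ∈ lipOne) :
    |fwdDiff 1 (steinSol a b f) (i + 1)| ≤ -fwdDiff 1 (linSol a b) (i + 1) + χ (i + 1) := by
  have ht := tent_mem_lipOne (i + 1)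
  have htent : fwdDiff 1 (steinSol a b (tent (i + 1))) (i + 1) ≤
      -fwdDiff 1 (linSol a b) (i + 1) + χ (i + 1) := by
    have := nonneg_of_shiftGen_le ha hb (κ := fun j => 2 * (1 + 2 * b * j) + 2 * b)
      (((boundedSeq_linSol ha hb).fwdDiff.neg.add hχ).add
        (boundedSeq_steinSol ha hb (.of_lipOne ht)).fwdDiff.neg)
      (fun j => by linarith [one_le_killing hb one_le_two j]) (fun j => Or.inr ?_) i
    · linarith
    · rw [shiftGen_add, shiftGen_add, shiftGen_neg, shiftGen_neg, shiftGen_fwdDiff_linSol ha,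
        shiftGen_fwdDiff_steinSol ha, tent_second_difference]
      have h1 := h j
      have h2 := neg_le_of_abs_le (abs_steinSol_le ha hb ht j)
      have h3 := mul_le_mul_of_nonneg_left h2 hb
      have e1 : linSol a b (j + 2) = linSol a b (j + 1) + fwdDiff 1 (linSol a b) (j + 1) := by
        simp only [fwdDiff]; ring
      have e2 : steinSol a b (tent (i + 1)) (j + 2) = steinSol a b (tent (i + 1)) (j + 1) +
          fwdDiff 1 (steinSol a b (tent (i + 1))) (j + 1) := by
        simp only [fwdDiff]; ring
      rw [e1, e2]
      linarith
  have key : ∀ f ∈ lipOne, fwdDiff 1 (steinSol a b f) (i + 1) ≤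
      fwdDiff 1 (steinSol a b (tent (i + 1))) (i + 1) := by
    intro f hf
    have g1 := LinearGrowth.of_lipOne ht
    have g2 := LinearGrowth.of_lipOne hf
    have := fwdDiff_steinSol_nonneg ha hb (g1.sub g2) (i := i + 1) (by omega) (fun x => by
      have h1 := neg_le_of_abs_le (hf x (i + 1))
      simp only [tent, sub_self, abs_zero]
      linarith)
    simp only [fwdDiff, steinSol_sub ha hb g1 g2] at this ⊢
    linarith
  refine abs_le.2 ⟨?_, (key f hf).trans htent⟩
  have h1 := (key _ (neg_mem_lipOne hf)).trans htent
  simp only [fwdDiff, steinSol_neg] at h1 ⊢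
  linarith

theorem fwdDiff_steinSol_zero (ha : 0 < a) (f : ℕ → ℝ) : fwdDiff 1 (steinSol a b f) 0 = 0 :=
  sub_eq_zero.2 (isSteinSolution_steinSol ha f).2.symm

theorem abs_fwdDiff_steinSol_le_div (ha : 0 < a) (hb : 0 ≤ b) {f : ℕ → ℝ} (hf : f ∈ lipOne)
    (i : ℕ) : |fwdDiff 1 (steinSol a b f) i| ≤
      1 / (1 + b) + (a + 2 * b) / (a ^ 2 + 2 * a + 2 + 2 * b * (a + 1)) := by
  cases i with
  | zero => rw [fwdDiff_steinSol_zero ha, abs_zero]; positivity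
  | succ i =>
    have := abs_fwdDiff_steinSol_le ha hb (i := i) (χ := fun _ => 1 / (1 + b))
      ⟨_, fun _ => le_rfl⟩ (fun j => ?_) hf
    · linarith [neg_fwdDiff_linSol_le_div ha hb i]
    · have h1 : (2 * (1 + 2 * b * j) + 2 * b) * (1 / (1 + b)) =
          2 + 4 * b * j * (1 / (1 + b)) := by field_simp; ring
      have h2 : 0 ≤ 4 * b * j * (1 / (1 + b)) := by positivity
      simp only [shiftGen, sub_self, mul_zero, add_zero]
      rw [h1]
      split_ifs <;> linarith

theorem abs_fwdDiff_steinSol_le_sqrt (ha : 0 < a) (hb : 0 < b) {f : ℕ → ℝ} (hf : f ∈ lipOne)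
    (i : ℕ) : |fwdDiff 1 (steinSol a b f) i| ≤ 1 / √(a * b) + 1 / a := by
  cases i with
  | zero => rw [fwdDiff_steinSol_zero ha, abs_zero]; positivity
  | succ k =>
    -- The supersolution drops by the factor `1 - δ` right after the site `k + 1`; `δ` is the
    -- largest drop that the killing at the site `k + 2` can compensate.
    set κ : ℕ → ℝ := fun j => 2 * (1 + 2 * b * j) + 2 * b with hκ
    have hκpos (j : ℕ) : 0 < κ j := by positivity
    have hβ : deathRate b (k + 1) + κ (k + 1) = (k + 3) * (1 + b * (k + 2)) := by
      simp only [hκ, deathRate]; push_cast; ring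
    have hd := deathRate_nonneg hb.le (k + 1)
    have hβpos : 0 < deathRate b (k + 1) + κ (k + 1) := by linarith [hκpos (k + 1)]
    set δ := κ (k + 1) / (deathRate b (k + 1) + κ (k + 1)) with hδ
    have hδ1 : δ ≤ 1 := by rw [hδ, div_le_one hβpos]; linarith
    have hδ2 : δ * (deathRate b (k + 1) + κ (k + 1)) = κ (k + 1) :=
      div_mul_cancel₀ _ hβpos.ne'
    have hδ0 : 0 ≤ δ := div_nonneg (hκpos _).le hβpos.le
    have hsqrt : 0 < √(a * b) := Real.sqrt_pos.2 (by positivity)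
    have hprod : a * b ≤ κ k * (a * δ) := by
      have h1 : b * (deathRate b (k + 1) + κ (k + 1)) ≤ κ k * κ (k + 1) := by
        rw [hβ]
        have h2 : κ k * κ (k + 1) - b * (((k : ℝ) + 3) * (1 + b * (k + 2))) =
            4 + b * (15 * k + 13) + b ^ 2 * (15 * (k : ℝ) ^ 2 + 27 * k + 6) := by
          simp only [hκ]; push_cast; ring
        have h3 : 0 ≤ 4 + b * (15 * k + 13) + b ^ 2 * (15 * (k : ℝ) ^ 2 + 27 * k + 6) := by
          positivity
        linarith
      have h2 : b ≤ κ k * δ := by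
        rw [hδ, ← mul_div_assoc, le_div_iff₀ hβpos]; exact h1
      linarith [mul_le_mul_of_nonneg_left h2 ha.le]
    -- the arithmetic-geometric mean inequality
    have hsum : 2 * √(a * b) ≤ κ k + a * δ := by
      have h1 : a * b ≤ ((κ k + a * δ) / 2) ^ 2 := by nlinarith [sq_nonneg (κ k - a * δ)]
      have h2 : 0 ≤ (κ k + a * δ) / 2 := by
        have := hκpos k
        have := mul_nonneg ha.le hδ0
        linarith
      have h3 := Real.sqrt_le_sqrt h1
      rw [Real.sqrt_sq h2] at h3
      linarith
    set c := 1 / √(a * b) with hc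
    have hc0 : 0 < c := by positivity
    have hc2 : 2 ≤ c * (κ k + a * δ) := by
      have h1 := mul_le_mul_of_nonneg_left hsum hc0.le
      have h2 : c * √(a * b) = 1 := one_div_mul_cancel hsqrt.ne'
      linarith
    have hlow : 0 ≤ c * (1 - δ) := mul_nonneg hc0.le (by linarith)
    set χ : ℕ → ℝ := fun j => if j ≤ k + 1 then c else c * (1 - δ) with hχ
    have χl {j : ℕ} (h : j ≤ k + 1) : χ j = c := if_pos h
    have χr {j : ℕ} (h : k + 1 < j) : χ j = c * (1 - δ) := if_neg (not_le.2 h)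
    have hbound : BoundedSeq χ := by
      refine ⟨c, fun j => ?_⟩
      rcases le_or_gt j (k + 1) with h | h
      · rw [χl h, abs_of_pos hc0]
      · rw [χr h, abs_of_nonneg hlow]
        linarith [mul_nonneg hc0.le hδ0]
    have := abs_fwdDiff_steinSol_le ha hb.le (i := k) hbound (fun j => ?_) hf
    · rw [χl le_rfl] at this
      linarith [neg_fwdDiff_linSol_le_one_div ha hb.le k]
    · change shiftGen a b χ j ≤ κ j * χ (j + 1) - _
      simp only [shiftGen]
      rcases lt_trichotomy j k with h | rfl | h
      · rw [χl (show j ≤ k + 1 by omega), χl (show j + 1 ≤ k + 1 by omega),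
          χl (show j + 2 ≤ k + 1 by omega), if_neg (by omega)]
        linarith [mul_pos (hκpos j) hc0]
      · rw [χl (show j ≤ j + 1 by omega), χl le_rfl, χr (show j + 1 < j + 2 by omega), if_pos rfl]
        linarith
      · rcases (Nat.succ_le_of_lt h).eq_or_lt with rfl | h2
        · rw [χl le_rfl, χr (show k + 1 < k.succ + 1 by omega),
            χr (show k + 1 < k.succ + 2 by omega),
            if_neg (by omega)]
          have h3 : κ (k + 1) * (c * (1 - δ)) =
              c * (δ * (deathRate b (k + 1) + κ (k + 1)) - δ * κ (k + 1)) := by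
            rw [hδ2]; ring
          change _ ≤ κ (k + 1) * (c * (1 - δ)) - 0
          rw [h3]
          simp only [Nat.succ_eq_add_one]
          linarith
        · rw [χr (show k + 1 < j by omega), χr (show k + 1 < j + 1 by omega),
            χr (show k + 1 < j + 2 by omega), if_neg (by omega)]
          linarith [mul_nonneg (hκpos j).le hlow]

/-- The second difference of a Stein solution at `i` is at most that for `-n + 2 · 1_{n > i}`. -/
theorem fwdDiff2_steinSol_le (ha : 0 < a) (hb : 0 ≤ b) {f : ℕ → ℝ} (hf : f ∈ lipOne) (i : ℕ) :
    fwdDiff 1 (fwdDiff 1 (steinSol a b f)) (i + 1) ≤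
      2 / a + b / ((a + 1) * b + 1 + a / 2) := by
  have g1 := LinearGrowth.natCast.neg
  have g2 := (linearGrowth_stepFun (i + 1)).const_mul 2
  have g3 := LinearGrowth.of_lipOne hf
  have hnn := fwdDiff2_steinSol_nonneg ha hb ((g1.add g2).sub g3) (i := i + 1) (by omega)
    (fun x hx => ?_) (fun x hx => ?_) ?_
  · have h1 := fwdDiff2_linSol_le ha hb i
    have h2 := fwdDiff2_steinSol_stepFun_le ha hb (i + 1)
    have h3 : 2 / a = 2 * (1 / a) := by ring
    simp only [fwdDiff, steinSol_sub ha hb (g1.add g2) g3, steinSol_add ha hb g1 g2,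
      steinSol_const_mul] at hnn h1 h2 ⊢
    simp only [linSol] at h1
    linarith
  · have h1 := hf x (i + 1)
    have hx' : (x : ℝ) ≤ ((i + 1 : ℕ) : ℝ) := by exact_mod_cast hx
    rw [abs_of_nonpos (sub_nonpos.2 hx')] at h1
    rw [stepFun_of_le hx, stepFun_of_le le_rfl]
    linarith [le_of_abs_le h1]
  · have h1 := hf x (i + 1 + 1)
    have hx' : ((i + 1 + 1 : ℕ) : ℝ) ≤ x := by exact_mod_cast hx
    rw [abs_of_nonneg (sub_nonneg.2 hx')] at h1
    rw [stepFun_of_lt (by omega), stepFun_of_lt (by omega)]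
    linarith [neg_le_of_abs_le h1]
  · rw [stepFun_of_le le_rfl, stepFun_of_lt (by omega)]
    have h1 := le_of_abs_le (abs_sub_succ_le hf (i + 1))
    push_cast
    linarith

theorem abs_sub_pbdExp_le (ha : 0 < a) (hb : 0 ≤ b) {f : ℕ → ℝ} (hf : f ∈ lipOne) :
    |f 0 - pbdExp a b f| ≤ pbdMean a b := by
  have key : ∀ f ∈ lipOne, f 0 - pbdExp a b f ≤ pbdMean a b := by
    intro f hf
    have h1 := pbdExp_mono ha hb (LinearGrowth.const (f 0))
      ((LinearGrowth.of_lipOne hf).add LinearGrowth.natCast) fun n => by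
        linarith [neg_le_of_abs_le (lipOne_abs_sub_le hf n)]
    rw [pbdExp_const ha hb, pbdExp_add ha hb (.of_lipOne hf) .natCast] at h1
    rw [pbdMean]; linarith
  refine abs_le.2 ⟨?_, key f hf⟩
  have h1 := key _ (neg_mem_lipOne hf)
  rw [pbdExp_neg] at h1
  linarith

theorem abs_fwdDiff2_steinSol_le (ha : 0 < a) (hb : 0 ≤ b) {f : ℕ → ℝ} (hf : f ∈ lipOne) (i : ℕ) :
    |fwdDiff 1 (fwdDiff 1 (steinSol a b f)) i| ≤ 2 / a + b / ((a + 1) * b + 1 + a / 2) := by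
  cases i with
  | zero =>
    have e : fwdDiff 1 (fwdDiff 1 (steinSol a b f)) 0 = fwdDiff 1 (steinSol a b f) 1 :=
      (congrArg _ (fwdDiff_steinSol_zero ha f)).trans (sub_zero _)
    have h1 : |a ^ 2 * fwdDiff 1 (steinSol a b f) 1| ≤ a * 1 + a := by
      rw [fwdDiff_steinSol_one ha]
      refine (abs_add_le _ _).trans (add_le_add ?_
        ((abs_sub_pbdExp_le ha hb hf).trans (mean_le ha hb)))
      rw [abs_mul, abs_of_pos ha]
      exact mul_le_mul_of_nonneg_left (abs_sub_succ_le hf 0) ha.le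
    rw [abs_mul, abs_of_pos (by positivity)] at h1
    have h2 : |fwdDiff 1 (steinSol a b f) 1| ≤ 2 / a := by
      rw [le_div_iff₀ ha]
      refine le_of_mul_le_mul_left ?_ ha
      linarith
    rw [e]
    exact h2.trans (le_add_of_nonneg_right (by positivity))
  | succ i =>
    refine abs_le.2 ⟨?_, fwdDiff2_steinSol_le ha hb hf i⟩
    have h1 := fwdDiff2_steinSol_le ha hb (neg_mem_lipOne hf) i
    simp only [fwdDiff, steinSol_neg] at h1 ⊢
    linarith

theorem iSup_supNorm_le {S : Set (ℕ → ℝ)} {u : (ℕ → ℝ) → ℕ → ℝ} {c : ℝ}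
    (h : ∀ f ∈ S, ∀ i, |u f i| ≤ c) : (⨆ f ∈ S, supNorm (u f)) ≤ (c : EReal) :=
  iSup₂_le fun f hf => iSup_le fun i => EReal.coe_le_coe_iff.2 (h f hf i)

end Bounds

theorem mainTheorem2 (a b : ℝ) (ha : 0 < a) (hb : 0 ≤ b) :
    -- the distribution, the expectations and the solutions are well defined
    ((∀ n, 0 ≤ pbd a b n) ∧ HasSum (pbd a b) 1) ∧
    (∀ f ∈ lipOne, Summable (fun n => |f n| * pbd a b n) ∧ ∃! g, IsSteinSolution a b f g) ∧
    -- the bounds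
    ∀ g : (ℕ → ℝ) → ℕ → ℝ, (∀ f ∈ lipOne, IsSteinSolution a b f (g f)) →
      (0 < b →
        (⨆ f ∈ lipOne, supNorm (g f)) ≤
            ((min (1 / (1 + 2 * a * b / (a + 2 * b + 2)))
              ((√(a * b + (b - 1) ^ 2 / 4) + (b - 1) / 2) / (a * b)) : ℝ) : EReal) ∧
        (⨆ f ∈ lipOne, supNorm (fwdDiff 1 (g f))) ≤
            ((min (1 / (1 + b) + (a + 2 * b) / (a ^ 2 + 2 * a + 2 + 2 * b * (a + 1)))
              (1 / √(a * b) + 1 / a) : ℝ) : EReal) ∧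
        (⨆ f ∈ lipOne, supNorm (fwdDiff 1 (fwdDiff 1 (g f)))) ≤
            ((2 / a + b / ((a + 1) * b + 1 + a / 2) : ℝ) : EReal)) ∧
      (b = 0 →
        (⨆ f ∈ lipOne, supNorm (g f)) ≤ ((1 : ℝ) : EReal) ∧
        (⨆ f ∈ lipOne, supNorm (fwdDiff 1 (g f))) ≤
            (((a ^ 2 + 3 * a + 2) / (a ^ 2 + 2 * a + 2) : ℝ) : EReal) ∧
        (⨆ f ∈ lipOne, supNorm (fwdDiff 1 (fwdDiff 1 (g f)))) ≤ ((2 / a : ℝ) : EReal)) := by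
  refine ⟨⟨fun n => (pbd_pos ha hb n).le, hasSum_pbd ha hb⟩, fun f hf =>
    ⟨(LinearGrowth.of_lipOne hf).summable_abs ha hb, steinSol a b f,
      isSteinSolution_steinSol ha f, fun g hg => hg.eq_steinSol ha⟩, fun g hg => ?_⟩
  have e : ∀ f ∈ lipOne, g f = steinSol a b f := fun f hf => (hg f hf).eq_steinSol ha
  refine ⟨fun hb0 => ⟨?_, ?_, ?_⟩, fun hb0 => ⟨?_, ?_, ?_⟩⟩
  · refine iSup_supNorm_le fun f hf i => ?_
    rw [e f hf]
    exact (abs_steinSol_le_mean ha hb hf i).trans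
      (le_min (mean_div_le ha hb) (mean_div_le_sqrt ha hb0))
  · refine iSup_supNorm_le (u := fun f => fwdDiff 1 (g f)) fun f hf i => ?_
    rw [e f hf]
    exact le_min (abs_fwdDiff_steinSol_le_div ha hb hf i)
      (abs_fwdDiff_steinSol_le_sqrt ha hb0 hf i)
  · refine iSup_supNorm_le (u := fun f => fwdDiff 1 (fwdDiff 1 (g f))) fun f hf i => ?_
    rw [e f hf]
    exact abs_fwdDiff2_steinSol_le ha hb hf i
  · refine iSup_supNorm_le fun f hf i => ?_
    rw [e f hf]
    exact (abs_steinSol_le_mean ha hb hf i).trans ((div_le_one ha).2 (mean_le ha hb))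
  · refine iSup_supNorm_le (u := fun f => fwdDiff 1 (g f)) fun f hf i => ?_
    rw [e f hf]
    refine (abs_fwdDiff_steinSol_le_div ha hb hf i).trans (le_of_eq ?_)
    rw [hb0]
    field_simp
    ring
  · refine iSup_supNorm_le (u := fun f => fwdDiff 1 (fwdDiff 1 (g f))) fun f hf i => ?_
    rw [e f hf]
    refine (abs_fwdDiff2_steinSol_le ha hb hf i).trans (le_of_eq ?_)
    rw [hb0, zero_div, add_zero]
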